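/- Let $F$ be an algebraically closed field of characteristic zero. For $t\in F$ consider the following $F$-linear categories (Deligne categories); in each case $\mathrm{Rep}$ is the pseudo-abelian envelope (Karoubi envelope of the additive envelope) of an $F$-linear category $\mathrm{Rep}'$ given by objects, bases of morphisms and a composition rule. (S) $\mathrm{Rep}'(S_t,F)$ has objects $[U]$ for finite sets $U$. $\mathrm{Hom}([U],[V])$ has as basis the recollements of $U,V$, i.e. the equivalence relations on $U\sqcup V$ that are trivial on $U$ and on $V$ (equivalently, pairs of jointly surjective injections of $U$ and $V$ into a set, up to isomorphism). The composition is $(D)\circ(C)=\sum_E P^E_{C,D}(t)\,(E)$, where $P^E_{C,D}(T)=\sum_F (T-|E|)(T-|E|-1)\cdots(T-|F|+1)$, the sum being over all recollements $F$ of $U,V,W$ that induce $C$ on $U\sqcup V$, $D$ on $V\sqcup W$ and $E$ on $U\sqcup W$, and $|\cdot|$ denotes the number of classes. $\mathrm{Rep}(S_t,F)^{(N)}$ is built in the same way using only the $U$ with $|U|\le N$. (GL) $\mathrm{Rep}'(GL_t,F)$ has objects $(p,q)\in\mathbb{N}^2$ (standing for $V^{\otimes p}\otimes (V^*)^{\otimes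 q}$). $\mathrm{Hom}$ has as basis the walled Brauer diagrams, i.e. the perfect matchings of the tensor factors of source and target in which partners are of the same kind ($V$ or $V^*$) if one is in the source and one in the target, and of opposite kinds otherwise. Diagrams are composed by stacking, each closed loop being replaced by $t$. $\mathrm{Rep}(GL_t,F)^{(N)}$ uses only the $(p,q)$ with $p+q\le N$. (O) $\mathrm{Rep}'(O_t,F)$ has objects $m\in\mathbb{N}$ (standing for $V^{\otimes m}$). $\mathrm{Hom}(m,n)$ has as basis the perfect matchings of the $m+n$ points of source and target (Brauer diagrams). Diagrams are composed by stacking, each closed loop being replaced by $t$. $\mathrm{Rep}(O_t,F)^{(N)}$ uses only the $m\le N$. (Sp) $\mathrm{Rep}'(Sp_t,F)$, where $t$ is the dimension of the standard object $V$ (so that $t=2n$ interpolates $Sp_{2n}$), has the same objects and bases as in (O), a matching standing for the map given by the symplectic form on pairs in the source, its inverse on pairs in the target (arguments from left to right) and the identity on pairs joining source and target. The composite of $C$ and $D$ is $(-1)^{c(C)+c(D)+c(E)}(-t)^{\ell}\,E$, where $E$ is the stacked diagram, $\ell$ is the number of closed loops and $c$ is the number of crossings. $\mathrm{Rep}(Sp_t,F)^{(N)}$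 uses only the $m\le N$. Then for each of the four families $\mathrm{Rep}(G_t,F)$, $G\in\{S,GL,O,Sp\}$: (1) for every $N\ge 0$, the category $\mathrm{Rep}(G_t,F)^{(N)}$ is semisimple abelian (abelian, with every object a finite direct sum of simple objects) for all but finitely many $t\in F$, and every exceptional $t$ is algebraic over $\mathbb{Q}$; (2) $\mathrm{Rep}(G_t,F)$ is semisimple abelian for every $t\in F$ that is transcendental over $\mathbb{Q}$. -/

import Mathlib

open CategoryTheory

namespace DeligneCat

noncomputable section

/-! ## Linear categories given by structure constants -/

/-- Structure constants of an `R`-linear category with set of objects `Ob`: the morphisms from `X` to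
`Y` are free on the finite set `Basis X Y`, the composite of the basis elements `C` (first) and
`D` (second) is `∑ E, coeff C D E • E`, and the identities are basis elements. -/
structure LinearPresentation (R : Type*) [CommRing R] (Ob : Type*) where
  Basis : Ob → Ob → Type
  basisFintype : ∀ X Y, Fintype (Basis X Y)
  coeff : ∀ {X Y Z : Ob}, Basis X Y → Basis Y Z → Basis X Z → R
  one : ∀ X, Basis X X
  one_coeff_self : ∀ {X Y : Ob} (D : Basis X Y), coeff (one X) D D = 1
  one_coeff_ne : ∀ {X Y : Ob} (D E : Basis X Y), D ≠ E → coeff (one X) D E = 0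
  coeff_one_self : ∀ {X Y : Ob} (D : Basis X Y), coeff D (one Y) D = 1
  coeff_one_ne : ∀ {X Y : Ob} (D E : Basis X Y), D ≠ E → coeff D (one Y) E = 0
  assoc : ∀ {X Y Z T : Ob} (A : Basis X Y) (B : Basis Y Z) (C : Basis Z T) (G : Basis X T),
    ∑ E, coeff A B E * coeff E C G = ∑ E, coeff B C E * coeff A E G

namespace LinearPresentation

attribute [instance] basisFintype

/-- Base change along a homomorphism of commutative rings. -/
def map {R S : Type*} [CommRing R] [CommRing S] {Ob : Type*} (P : LinearPresentation R Ob)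
    (φ : R →+* S) : LinearPresentation S Ob where
  Basis := P.Basis
  basisFintype := P.basisFintype
  coeff C D E := φ (P.coeff C D E)
  one := P.one
  one_coeff_self D := by simp [P.one_coeff_self]
  one_coeff_ne D E h := by simp [P.one_coeff_ne D E h]
  coeff_one_self D := by simp [P.coeff_one_self]
  coeff_one_ne D E h := by simp [P.coeff_one_ne D E h]
  assoc A B C G := by simp only [← map_mul, ← map_sum, P.assoc]

/-- The category with the given structure constants; its objects are those of `Ob`. -/
structure Cat {R : Type*} [CommRing R] {Ob : Type*} (P : LinearPresentation R Ob) where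
  ob : Ob

section

variable {R : Type*} [CommRing R] {Ob : Type*} (P : LinearPresentation R Ob)

open Classical in
instance : Category P.Cat where
  Hom X Y := P.Basis X.ob Y.ob → R
  id X := Pi.single (P.one X.ob) 1
  comp φ ψ := fun E => ∑ C, ∑ D, φ C * ψ D * P.coeff C D E
  id_comp {X Y} ψ := by
    funext E
    rw [Finset.sum_eq_single (P.one X.ob), Finset.sum_eq_single E]
    · simp [P.one_coeff_self]
    · intro D _ h
      simp [P.one_coeff_ne D E h]
    · simp
    · intro C _ h
      simp [h]
    · simp
  comp_id {X Y} ψ := by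
    funext E
    rw [Finset.sum_comm, Finset.sum_eq_single (P.one Y.ob), Finset.sum_eq_single E]
    · simp [P.coeff_one_self]
    · intro D _ h
      simp [P.coeff_one_ne D E h]
    · simp
    · intro C _ h
      simp [h]
    · simp
  assoc {X Y Z T} φ ψ χ := by
    funext G
    have hL : ∑ E, ∑ C, (∑ A, ∑ B, φ A * ψ B * P.coeff A B E) * χ C * P.coeff E C G
        = ∑ A, ∑ B, ∑ C, φ A * ψ B * χ C * ∑ E, P.coeff A B E * P.coeff E C G := by
      simp only [Finset.sum_mul, Finset.mul_sum]
      rw [Finset.sum_comm]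
      simp only [fun C => Finset.sum_comm (s := (Finset.univ : Finset (P.Basis X.ob Z.ob)))
        (t := (Finset.univ : Finset (P.Basis X.ob Y.ob)))
        (f := fun E A => ∑ B, φ A * ψ B * P.coeff A B E * χ C * P.coeff E C G)]
      rw [Finset.sum_comm]
      refine Finset.sum_congr rfl fun A _ => ?_
      simp only [fun C => Finset.sum_comm (s := (Finset.univ : Finset (P.Basis X.ob Z.ob)))
        (t := (Finset.univ : Finset (P.Basis Y.ob Z.ob)))
        (f := fun E B => φ A * ψ B * P.coeff A B E * χ C * P.coeff E C G)]
      rw [Finset.sum_comm]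
      refine Finset.sum_congr rfl fun B _ => Finset.sum_congr rfl fun C _ =>
        Finset.sum_congr rfl fun E _ => by ring
    have hR : ∑ A, ∑ E, φ A * (∑ B, ∑ C, ψ B * χ C * P.coeff B C E) * P.coeff A E G
        = ∑ A, ∑ B, ∑ C, φ A * ψ B * χ C * ∑ E, P.coeff B C E * P.coeff A E G := by
      refine Finset.sum_congr rfl fun A _ => ?_
      simp only [Finset.sum_mul, Finset.mul_sum]
      rw [Finset.sum_comm]
      refine Finset.sum_congr rfl fun B _ => ?_
      rw [Finset.sum_comm]
      refine Finset.sum_congr rfl fun C _ => Finset.sum_congr rfl fun E _ => by ring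
    change ∑ E, ∑ C, (∑ A, ∑ B, φ A * ψ B * P.coeff A B E) * χ C * P.coeff E C G
      = ∑ A, ∑ E, φ A * (∑ B, ∑ C, ψ B * χ C * P.coeff B C E) * P.coeff A E G
    rw [hL, hR]
    simp only [P.assoc]

instance (X Y : P.Cat) : AddCommGroup (X ⟶ Y) :=
  inferInstanceAs (AddCommGroup (P.Basis X.ob Y.ob → R))

instance (X Y : P.Cat) : Module R (X ⟶ Y) :=
  inferInstanceAs (Module R (P.Basis X.ob Y.ob → R))

theorem comp_apply {X Y Z : P.Cat} (φ : X ⟶ Y) (ψ : Y ⟶ Z) (E : P.Basis X.ob Z.ob) :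
    (φ ≫ ψ) E = ∑ C, ∑ D, φ C * ψ D * P.coeff C D E := rfl

instance : Preadditive P.Cat where
  add_comp X Y Z φ φ' ψ := by
    funext E
    change ∑ C, ∑ D, (φ C + φ' C) * ψ D * P.coeff C D E
      = ∑ C, ∑ D, φ C * ψ D * P.coeff C D E + ∑ C, ∑ D, φ' C * ψ D * P.coeff C D E
    simp only [add_mul, Finset.sum_add_distrib]
  comp_add X Y Z φ ψ ψ' := by
    funext E
    change ∑ C, ∑ D, φ C * (ψ D + ψ' D) * P.coeff C D E
      = ∑ C, ∑ D, φ C * ψ D * P.coeff C D E + ∑ C, ∑ D, φ C * ψ' D * P.coeff C D E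
    simp only [add_mul, mul_add, Finset.sum_add_distrib]

instance : Linear R P.Cat where
  smul_comp X Y Z r φ ψ := by
    funext E
    change ∑ C, ∑ D, (r * φ C) * ψ D * P.coeff C D E = r * ∑ C, ∑ D, φ C * ψ D * P.coeff C D E
    simp only [Finset.mul_sum, mul_assoc]
  comp_smul X Y Z φ r ψ := by
    funext E
    change ∑ C, ∑ D, φ C * (r * ψ D) * P.coeff C D E = r * ∑ C, ∑ D, φ C * ψ D * P.coeff C D E
    simp only [Finset.mul_sum]
    exact Finset.sum_congr rfl fun C _ => Finset.sum_congr rfl fun D _ => by ring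

end

end LinearPresentation

/-! ## Finite sets, equivalence relations and gluing -/

theorem finite_setoid (α : Type*) [Finite α] : Finite (Setoid α) :=
  Finite.of_injective (fun s : Setoid α => fun a b => s a b) fun s t h =>
    Setoid.ext fun a b => by rw [show s a b = t a b from congrFun (congrFun h a) b]

instance (α : Type*) [Finite α] : Finite (Setoid α) := finite_setoid α

section Glue

variable {U V W Z : Type}

/-- The inclusion of `U ⊔ V` into `U ⊔ V ⊔ W`. -/
def incl₁₂ : U ⊕ V → U ⊕ (V ⊕ W) := Sum.map id Sum.inl

/-- The inclusion of `V ⊔ W` into `U ⊔ V ⊔ W`. -/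
def incl₂₃ : V ⊕ W → U ⊕ (V ⊕ W) := Sum.inr

/-- The inclusion of `U ⊔ W` into `U ⊔ V ⊔ W`. -/
def incl₁₃ : U ⊕ W → U ⊕ (V ⊕ W) := Sum.map id Sum.inr

/-- The equivalence relation identifying the two copies of each element of `U`. -/
def diag (U : Type) : Setoid (U ⊕ U) := Setoid.ker (Sum.elim id id)

/-- The equivalence relation on `U ⊔ V ⊔ W` generated by `C` on `U ⊔ V` and `D` on `V ⊔ W`. -/
def glue (C : Setoid (U ⊕ V)) (D : Setoid (V ⊕ W)) : Setoid (U ⊕ (V ⊕ W)) :=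
  sInf {F | C ≤ F.comap incl₁₂ ∧ D ≤ F.comap incl₂₃}

/-- Stacking of diagrams: the restriction of `glue C D` to `U ⊔ W`. -/
def stack (C : Setoid (U ⊕ V)) (D : Setoid (V ⊕ W)) : Setoid (U ⊕ W) :=
  (glue C D).comap incl₁₃

/-- The number of classes of `glue C D` which are contained in the middle set `V`. -/
def loops (C : Setoid (U ⊕ V)) (D : Setoid (V ⊕ W)) : ℕ :=
  Nat.card {q : Quotient (glue C D) // ∀ x : U ⊕ W, Quotient.mk (glue C D) (incl₁₃ x) ≠ q}

theorem le_glue (C : Setoid (U ⊕ V)) (D : Setoid (V ⊕ W)) :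
    C ≤ (glue C D).comap incl₁₂ ∧ D ≤ (glue C D).comap incl₂₃ :=
  ⟨fun _ _ h _ hF => hF.1 h, fun _ _ h _ hF => hF.2 h⟩

theorem glue_le_iff {C : Setoid (U ⊕ V)} {D : Setoid (V ⊕ W)} {F : Setoid (U ⊕ (V ⊕ W))} :
    glue C D ≤ F ↔ C ≤ F.comap incl₁₂ ∧ D ≤ F.comap incl₂₃ :=
  ⟨fun h => ⟨fun _ _ hx => h ((le_glue C D).1 hx), fun _ _ hx => h ((le_glue C D).2 hx)⟩,
    fun h => sInf_le h⟩

theorem comap_ker₁₂ {γ : Type} (f : U → γ) (g : V → γ) (h : W → γ) :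
    (Setoid.ker (Sum.elim f (Sum.elim g h))).comap incl₁₂ = Setoid.ker (Sum.elim f g) := by
  ext x y
  rcases x with x | x <;> rcases y with y | y <;> rfl

theorem comap_ker₂₃ {γ : Type} (f : U → γ) (g : V → γ) (h : W → γ) :
    (Setoid.ker (Sum.elim f (Sum.elim g h))).comap incl₂₃ = Setoid.ker (Sum.elim g h) := by
  ext x y
  rcases x with x | x <;> rcases y with y | y <;> rfl

theorem comap_ker₁₃ {γ : Type} (f : U → γ) (g : V → γ) (h : W → γ) :
    (Setoid.ker (Sum.elim f (Sum.elim g h))).comap incl₁₃ = Setoid.ker (Sum.elim f h) := by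
  ext x y
  rcases x with x | x <;> rcases y with y | y <;> rfl

open Classical in
/-- The number of colourings of the middle set compatible with `C` and `D`. -/
theorem sum_glue [Fintype V] [Finite U] [Finite W] (C : Setoid (U ⊕ V)) (D : Setoid (V ⊕ W))
    (n : ℕ) (f : U → Fin n) (h : W → Fin n) :
    (∑ g : V → Fin n, if C ≤ Setoid.ker (Sum.elim f g) ∧ D ≤ Setoid.ker (Sum.elim g h)
      then 1 else 0) = if stack C D ≤ Setoid.ker (Sum.elim f h) then n ^ loops C D else 0 := by
  have key : ∀ g : V → Fin n, (C ≤ Setoid.ker (Sum.elim f g) ∧ D ≤ Setoid.ker (Sum.elim g h)) ↔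
      glue C D ≤ Setoid.ker (Sum.elim f (Sum.elim g h)) := by
    intro g
    rw [glue_le_iff, comap_ker₁₂, comap_ker₂₃]
  simp only [key]
  split_ifs with hs
  · rw [Finset.sum_boole, ← Fintype.card_subtype]
    simp only [Nat.cast_id]
    set L := {q : Quotient (glue C D) // ∀ x : U ⊕ W, Quotient.mk (glue C D) (incl₁₃ x) ≠ q}
      with hL
    have hcard : Nat.card (L → Fin n) = n ^ loops C D := by
      rw [Nat.card_fun, Nat.card_eq_fintype_card, Fintype.card_fin]
      rfl
    rw [← hcard, ← Nat.card_eq_fintype_card]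
    have hex : ∀ q : Quotient (glue C D), (¬ ∀ x : U ⊕ W, Quotient.mk (glue C D) (incl₁₃ x) ≠ q) →
        ∃ x : U ⊕ W, Quotient.mk (glue C D) (incl₁₃ x) = q := by
      intro q hq
      by_contra hc
      exact hq fun x hx => hc ⟨x, hx⟩
    -- the colouring of all classes determined by a colouring of the inner ones
    let ext : (L → Fin n) → Quotient (glue C D) → Fin n := fun ψ q =>
      if hq : ∀ x : U ⊕ W, Quotient.mk (glue C D) (incl₁₃ x) ≠ q then ψ ⟨q, hq⟩
      else Sum.elim f h (Classical.choose (hex q hq))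
    have hext : ∀ ψ (x : U ⊕ W), ext ψ (Quotient.mk _ (incl₁₃ x)) = Sum.elim f h x := by
      intro ψ x
      have hq : ¬ ∀ y : U ⊕ W, Quotient.mk (glue C D) (incl₁₃ y) ≠
        Quotient.mk (glue C D) (incl₁₃ x) := fun H => H x rfl
      simp only [ext, dif_neg hq]
      have := Classical.choose_spec (hex _ hq)
      exact hs (show stack C D _ _ from Quotient.exact (s := glue C D) this)
    refine Nat.card_eq_of_bijective (fun g q => Quotient.lift (Sum.elim f (Sum.elim g.1 h))
      (fun a b hab => g.2 hab) q.1) ⟨?_, ?_⟩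
    · rintro ⟨g, hg⟩ ⟨g', hg'⟩ hgg'
      apply Subtype.ext
      funext v
      by_cases hq : ∀ x : U ⊕ W, Quotient.mk (glue C D) (incl₁₃ x) ≠
          Quotient.mk (glue C D) (Sum.inr (Sum.inl v))
      · exact congrFun hgg' ⟨_, hq⟩
      · obtain ⟨x, hx⟩ := hex _ hq
        have h1 := hg (Quotient.exact hx)
        have h2 := hg' (Quotient.exact hx)
        rcases x with x | x
        · exact h1.symm.trans h2
        · exact h1.symm.trans h2
    · intro ψ
      have hψ : Sum.elim f (Sum.elim (fun v => ext ψ (Quotient.mk _ (Sum.inr (Sum.inl v)))) h) =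
          fun x => ext ψ (Quotient.mk _ x) := by
        funext x
        rcases x with u | v | w
        · exact (hext ψ (Sum.inl u)).symm
        · rfl
        · exact (hext ψ (Sum.inr w)).symm
      refine ⟨⟨fun v => ext ψ (Quotient.mk _ (Sum.inr (Sum.inl v))), ?_⟩, ?_⟩
      · rw [hψ]
        intro a b hab
        exact congrArg (ext ψ) (Quotient.sound hab)
      · funext q
        obtain ⟨q, hq⟩ := q
        induction q using Quotient.inductionOn with
        | h x =>
          rcases x with u | v | w
          · exact absurd rfl (hq (Sum.inl u))
          · change ext ψ (Quotient.mk _ (Sum.inr (Sum.inl v))) = _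
            simp only [ext, dif_pos hq]
          · exact absurd rfl (hq (Sum.inr w))
  · refine Finset.sum_eq_zero fun g _ => if_neg fun hg => hs ?_
    rw [← comap_ker₁₃ f g h]
    exact fun _ _ hx => hg hx

theorem exists_ker [Finite U] [Finite V] (E : Setoid (U ⊕ V)) (n : ℕ)
    (hn : Nat.card (U ⊕ V) ≤ n) :
    ∃ (f : U → Fin n) (h : V → Fin n), E = Setoid.ker (Sum.elim f h) := by
  have : Nat.card (Quotient E) ≤ Nat.card (Fin n) := by
    rw [Nat.card_eq_fintype_card (α := Fin n), Fintype.card_fin]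
    exact (Nat.card_le_card_of_surjective _ (Quotient.mk_surjective (s := E))).trans hn
  obtain ⟨e⟩ : Nonempty (Quotient E ↪ Fin n) := by
    cases nonempty_fintype (Quotient E)
    rw [Nat.card_eq_fintype_card, Nat.card_eq_fintype_card] at this
    exact Function.Embedding.nonempty_of_card_le this
  refine ⟨fun u => e (Quotient.mk _ (Sum.inl u)), fun v => e (Quotient.mk _ (Sum.inr v)), ?_⟩
  have : Sum.elim (fun u => e (Quotient.mk _ (Sum.inl u))) (fun v => e (Quotient.mk _ (Sum.inr v)))
      = fun x => e (Quotient.mk E x) := by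
    funext x
    rcases x with x | x <;> rfl
  rw [this]
  ext a b
  exact ⟨fun h => congrArg e (Quotient.sound h), fun h => Quotient.exact (e.injective h)⟩

theorem diag_le_ker_iff {γ : Type} (f g : U → γ) :
    diag U ≤ Setoid.ker (Sum.elim f g) ↔ f = g := by
  constructor
  · intro h
    funext u
    exact h (x := Sum.inl u) (y := Sum.inr u) rfl
  · rintro rfl a b hab
    rcases a with a | a <;> rcases b with b | b <;> exact congrArg f hab

section

variable [Finite U] [Finite V] [Finite W] [Finite Z]

open Classical in
theorem stack_loops_unique {A B : Setoid (U ⊕ V)} {a b : ℕ}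
    (H : ∀ n : ℕ, ∀ (f : U → Fin n) (h : V → Fin n),
      (if A ≤ Setoid.ker (Sum.elim f h) then n ^ a else 0) =
        if B ≤ Setoid.ker (Sum.elim f h) then n ^ b else 0) : A = B ∧ a = b := by
  have h0 : ∀ (n k : ℕ), (n + 2) ^ k ≠ 0 := fun n k => by positivity
  have hAB : A = B := by
    obtain ⟨f, h, hA⟩ := exists_ker A (Nat.card (U ⊕ V) + 2) (by omega)
    obtain ⟨f', h', hB⟩ := exists_ker B (Nat.card (U ⊕ V) + 2) (by omega)
    apply le_antisymm
    · have := H _ f' h'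
      rw [← hB, if_pos le_rfl] at this
      by_contra hc
      rw [if_neg hc] at this
      exact h0 _ _ this.symm
    · have := H _ f h
      rw [← hA, if_pos le_rfl] at this
      by_contra hc
      rw [if_neg hc] at this
      exact h0 _ _ this
  refine ⟨hAB, ?_⟩
  obtain ⟨f, h, hA⟩ := exists_ker A (Nat.card (U ⊕ V) + 2) (by omega)
  have := H _ f h
  rw [← hAB, ← hA, if_pos le_rfl, if_pos le_rfl] at this
  exact Nat.pow_right_injective (by omega) this

theorem stack_assoc_aux (A : Setoid (U ⊕ V)) (B : Setoid (V ⊕ W)) (C : Setoid (W ⊕ Z)) :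
    stack (stack A B) C = stack A (stack B C) ∧
      loops A B + loops (stack A B) C = loops B C + loops A (stack B C) := by
  classical
  cases nonempty_fintype V
  cases nonempty_fintype W
  apply stack_loops_unique
  intro n f k
  have h1 : (if stack (stack A B) C ≤ Setoid.ker (Sum.elim f k) then
        n ^ (loops A B + loops (stack A B) C) else 0) =
      ∑ h : W → Fin n, ∑ g : V → Fin n, if (A ≤ Setoid.ker (Sum.elim f g) ∧
        B ≤ Setoid.ker (Sum.elim g h)) ∧ C ≤ Setoid.ker (Sum.elim h k) then 1 else 0 := by
    have : ∀ h : W → Fin n, (∑ g : V → Fin n, if (A ≤ Setoid.ker (Sum.elim f g) ∧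
        B ≤ Setoid.ker (Sum.elim g h)) ∧ C ≤ Setoid.ker (Sum.elim h k) then 1 else 0) =
        n ^ loops A B * if stack A B ≤ Setoid.ker (Sum.elim f h) ∧
          C ≤ Setoid.ker (Sum.elim h k) then 1 else 0 := by
      intro h
      by_cases hC : C ≤ Setoid.ker (Sum.elim h k)
      · simp only [hC, and_true, sum_glue]
        split_ifs <;> simp
      · simp [hC]
    simp only [this, ← Finset.mul_sum, sum_glue]
    split_ifs <;> simp [pow_add]
  have h2 : (if stack A (stack B C) ≤ Setoid.ker (Sum.elim f k) then
        n ^ (loops B C + loops A (stack B C)) else 0) =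
      ∑ g : V → Fin n, ∑ h : W → Fin n, if (A ≤ Setoid.ker (Sum.elim f g) ∧
        B ≤ Setoid.ker (Sum.elim g h)) ∧ C ≤ Setoid.ker (Sum.elim h k) then 1 else 0 := by
    have : ∀ g : V → Fin n, (∑ h : W → Fin n, if (A ≤ Setoid.ker (Sum.elim f g) ∧
        B ≤ Setoid.ker (Sum.elim g h)) ∧ C ≤ Setoid.ker (Sum.elim h k) then 1 else 0) =
        n ^ loops B C * if A ≤ Setoid.ker (Sum.elim f g) ∧
          stack B C ≤ Setoid.ker (Sum.elim g k) then 1 else 0 := by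
      intro g
      by_cases hA : A ≤ Setoid.ker (Sum.elim f g)
      · simp only [hA, true_and, sum_glue]
        split_ifs <;> simp
      · simp [hA]
    simp only [this, ← Finset.mul_sum, sum_glue]
    split_ifs <;> simp [pow_add]
  rw [h1, h2, Finset.sum_comm]

theorem diag_stack_aux (D : Setoid (U ⊕ V)) : stack (diag U) D = D ∧ loops (diag U) D = 0 := by
  classical
  cases nonempty_fintype U
  apply stack_loops_unique
  intro n f h
  rw [← sum_glue, Finset.sum_eq_single f]
  · simp [diag_le_ker_iff]
  · intro g _ hg
    simp [diag_le_ker_iff, hg.symm]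
  · simp

theorem stack_diag_aux (D : Setoid (U ⊕ V)) : stack D (diag V) = D ∧ loops D (diag V) = 0 := by
  classical
  cases nonempty_fintype V
  apply stack_loops_unique
  intro n f h
  rw [← sum_glue, Finset.sum_eq_single h]
  · simp [diag_le_ker_iff]
  · intro g _ hg
    simp [diag_le_ker_iff, hg]
  · simp

end

end Glue

/-! ## Perfect matchings -/

section Matching

/-- All classes have exactly two elements. -/
def IsMatching {α : Type*} (s : Setoid α) : Prop := ∀ x, ∃! y, y ≠ x ∧ s x y

/-- Related distinct elements have different colours. -/
def IsBicoloured {α : Type*} (c : α → Bool) (s : Setoid α) : Prop :=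
  ∀ x y, s x y → x ≠ y → c x ≠ c y

theorem IsMatching.exists_partner {α : Type*} {s : Setoid α} (hs : IsMatching s) :
    ∃ σ : α → α, (∀ x, σ (σ x) = x) ∧ (∀ x, σ x ≠ x) ∧ (∀ x, s x (σ x)) ∧
      ∀ x y, s x y → y = x ∨ y = σ x := by
  choose σ hσ hu using hs
  simp only at hσ hu
  refine ⟨σ, fun x => ?_, fun x => (hσ x).1, fun x => (hσ x).2, fun x y h => ?_⟩
  · exact (hu (σ x) x ⟨(hσ x).1.symm, s.symm' (hσ x).2⟩).symm
  · by_cases hyx : y = x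
    · exact Or.inl hyx
    · exact Or.inr (hu x y ⟨hyx, h⟩)

theorem diag_isMatching (U : Type) : IsMatching (diag U) := by
  rintro (u | u)
  · refine ⟨Sum.inr u, ⟨by simp, rfl⟩, ?_⟩
    rintro (v | v) ⟨h1, h2⟩
    · have h3 : u = v := h2
      exact absurd (congrArg Sum.inl h3.symm) h1
    · have h3 : u = v := h2
      rw [h3]
  · refine ⟨Sum.inl u, ⟨by simp, rfl⟩, ?_⟩
    rintro (v | v) ⟨h1, h2⟩
    · have h3 : u = v := h2
      rw [h3]
    · have h3 : u = v := h2
      exact absurd (congrArg Sum.inr h3.symm) h1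

theorem sum_orbit {T M : Type*} [Fintype T] [AddCommGroup M] (σ : T → T)
    (hσ : ∀ x, σ (σ x) = x) (K : T → Prop) (hK : ∀ x, K x → K (σ x)) (ε : T → M)
    (hε : ∀ x, σ x ≠ x → ε x + ε (σ x) = 0) [DecidablePred K] [DecidableEq T] :
    ∑ x with K x, (if σ x = x then 0 else ε x) = 0 := by
  refine Finset.sum_involution (fun x _ => σ x) ?_ ?_ ?_ ?_
  · intro x _
    by_cases hx : σ x = x
    · simp [hx]
    · have : ¬ σ (σ x) = σ x := fun h => hx (by rw [hσ] at h; exact h.symm)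
      rw [if_neg hx, if_neg this, hε x hx]
  · intro x _ hx hx'
    exact hx (if_pos hx')
  · intro x hx
    simp only [Finset.mem_filter, Finset.mem_univ, true_and] at hx ⊢
    exact hK x hx
  · intro x _
    exact hσ x

/-- For two involutions without common fixed points, the difference of the weighted numbers of
fixed points in an invariant set vanishes. -/
theorem sum_ends {T M : Type*} [Fintype T] [AddCommGroup M] (σ τ : T → T)
    (hσ : ∀ x, σ (σ x) = x) (hτ : ∀ x, τ (τ x) = x) (K : T → Prop)
    (hKσ : ∀ x, K x → K (σ x)) (hKτ : ∀ x, K x → K (τ x)) (ε : T → M)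
    (hεσ : ∀ x, σ x ≠ x → ε x + ε (σ x) = 0) (hετ : ∀ x, τ x ≠ x → ε x + ε (τ x) = 0)
    [DecidablePred K] [DecidableEq T] :
    ∑ x with K x, ((if τ x = x then ε x else 0) - if σ x = x then ε x else 0) = 0 := by
  have h1 := sum_orbit σ hσ K hKσ ε hεσ
  have h2 := sum_orbit τ hτ K hKτ ε hετ
  have h3 : ∀ x, ((if τ x = x then ε x else 0) - if σ x = x then ε x else 0) =
      (if σ x = x then 0 else ε x) - if τ x = x then 0 else ε x := by
    intro x
    split_ifs <;> simp
  simp only [h3, Finset.sum_sub_distrib, h1, h2, sub_zero]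

section TwoEnds

variable {T : Type*} [Fintype T] [DecidableEq T] {σ τ : T → T} {J : Setoid T}

theorem card_ends_le (hσ : ∀ x, σ (σ x) = x) (hτ : ∀ x, τ (τ x) = x)
    (hmin : ∀ F : Setoid T, (∀ x, F x (σ x)) → (∀ x, F x (τ x)) → J ≤ F)
    (a : T) [DecidablePred fun x => J a x] :
    (Finset.univ.filter fun x => J a x ∧ (σ x = x ∨ τ x = x)).card ≤ 2 := by
  classical
  let G : SimpleGraph T :=
    { Adj := fun x y => x ≠ y ∧ (y = σ x ∨ y = τ x)
      symm := ⟨by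
        rintro x y ⟨h, h' | h'⟩
        · exact ⟨h.symm, Or.inl (by rw [h', hσ])⟩
        · exact ⟨h.symm, Or.inr (by rw [h', hτ])⟩⟩
      loopless := ⟨fun x h => h.1 rfl⟩ }
  have hJG : J ≤ G.reachableSetoid := by
    apply hmin
    · intro x
      by_cases h : x = σ x
      · exact h ▸ SimpleGraph.Reachable.refl x
      · exact SimpleGraph.Adj.reachable ⟨h, Or.inl rfl⟩
    · intro x
      by_cases h : x = τ x
      · exact h ▸ SimpleGraph.Reachable.refl x
      · exact SimpleGraph.Adj.reachable ⟨h, Or.inr rfl⟩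
  let c := G.connectedComponentMk a
  let H := c.toSimpleGraph
  have hconn : H.Connected := c.connected_toSimpleGraph
  have h1 := hconn.card_vert_le_card_edgeSet_add_one
  have h2 := H.sum_degrees_eq_twice_card_edges
  have hdeg : ∀ v : c, H.degree v + (if σ v.1 = v.1 ∨ τ v.1 = v.1 then 1 else 0) ≤ 2 := by
    intro v
    have hsub : (H.neighborFinset v).image Subtype.val ⊆ ({σ v.1, τ v.1} : Finset T).erase v.1 := by
      intro y hy
      simp only [Finset.mem_image, SimpleGraph.mem_neighborFinset] at hy
      obtain ⟨w, hw, rfl⟩ := hy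
      have hw' : G.Adj v.1 w.1 := hw
      simp only [Finset.mem_erase, Finset.mem_insert, Finset.mem_singleton]
      exact ⟨hw'.1.symm, hw'.2⟩
    have hle := Finset.card_le_card hsub
    rw [Finset.card_image_of_injective _ Subtype.val_injective,
      SimpleGraph.card_neighborFinset_eq_degree] at hle
    split_ifs with hv
    · have : v.1 ∈ ({σ v.1, τ v.1} : Finset T) := by
        rcases hv with hv | hv <;> simp [hv]
      rw [Finset.card_erase_of_mem this] at hle
      have := Finset.card_le_two (a := σ v.1) (b := τ v.1)
      omega
    · have := Finset.card_le_two (a := σ v.1) (b := τ v.1)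
      have := Finset.card_erase_le (s := ({σ v.1, τ v.1} : Finset T)) (a := v.1)
      omega
  have h3 := Finset.sum_le_sum (s := Finset.univ) fun (v : c) _ => hdeg v
  rw [Finset.sum_add_distrib, h2, Finset.sum_boole, Finset.sum_const, Finset.card_univ] at h3
  have h4 : (Finset.univ.filter fun x => J a x ∧ (σ x = x ∨ τ x = x)).card ≤
      (Finset.univ.filter fun v : c => σ v.1 = v.1 ∨ τ v.1 = v.1).card := by
    rw [← Finset.card_image_of_injective _ (Subtype.val_injective (p := fun x => x ∈ c))]
    apply Finset.card_le_card
    intro x hx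
    simp only [Finset.mem_filter, Finset.mem_univ, true_and] at hx
    simp only [Finset.mem_image, Finset.mem_filter, Finset.mem_univ, true_and]
    refine ⟨⟨x, ?_⟩, hx.2, rfl⟩
    exact (SimpleGraph.ConnectedComponent.eq.2 (hJG hx.1)).symm
  have h5 : Nat.card c = Fintype.card c := Nat.card_eq_fintype_card
  have h6 : Nat.card H.edgeSet = H.edgeFinset.card := by
    rw [Nat.card_eq_fintype_card, SimpleGraph.edgeFinset_card]
  simp only [Nat.cast_id, smul_eq_mul] at h3
  omega

theorem two_ends (hσ : ∀ x, σ (σ x) = x) (hτ : ∀ x, τ (τ x) = x)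
    (hJσ : ∀ x, J x (σ x)) (hJτ : ∀ x, J x (τ x))
    (hmin : ∀ F : Setoid T, (∀ x, F x (σ x)) → (∀ x, F x (τ x)) → J ≤ F)
    (hno : ∀ x, ¬ (σ x = x ∧ τ x = x)) (a : T) (ha : σ a = a ∨ τ a = a) :
    ∃! b, b ≠ a ∧ J a b ∧ (σ b = b ∨ τ b = b) := by
  classical
  have h1 := card_ends_le hσ hτ hmin a
  have h2 := sum_ends (M := ZMod 2) σ τ hσ hτ (fun x => J a x)
    (fun x hx => J.trans' hx (hJσ x)) (fun x hx => J.trans' hx (hJτ x)) (fun _ => 1)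
    (fun _ _ => by decide) (fun _ _ => by decide)
  have h3 : ∀ x, (((if τ x = x then 1 else 0) - if σ x = x then 1 else 0 : ZMod 2)) =
      if σ x = x ∨ τ x = x then 1 else 0 := by
    intro x
    by_cases hx : σ x = x <;> by_cases hx' : τ x = x
    · exact absurd ⟨hx, hx'⟩ (hno x)
    · simp [hx, hx']
    · simp [hx, hx']
    · simp [hx, hx']
  simp only [h3, Finset.sum_boole, Finset.filter_filter] at h2
  rw [ZMod.natCast_eq_zero_iff] at h2
  have hmem : a ∈ Finset.univ.filter fun x => J a x ∧ (σ x = x ∨ τ x = x) := by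
    simp only [Finset.mem_filter, Finset.mem_univ, true_and]
    exact ⟨J.refl' a, ha⟩
  have h4 := Finset.card_pos.2 ⟨a, hmem⟩
  have h5 : (Finset.univ.filter fun x => J a x ∧ (σ x = x ∨ τ x = x)).card = 2 := by omega
  have h6 := Finset.card_erase_of_mem hmem
  rw [h5] at h6
  obtain ⟨b, hb⟩ := Finset.card_eq_one.1 h6
  have hb' : ∀ y, y ≠ a ∧ J a y ∧ (σ y = y ∨ τ y = y) ↔ y = b := by
    intro y
    have := Finset.ext_iff.1 hb y
    simpa only [Finset.mem_erase, Finset.mem_filter, Finset.mem_univ, true_and,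
      Finset.mem_singleton] using this
  exact ⟨b, (hb' b).2 rfl, fun y hy => (hb' y).1 hy⟩

theorem ends_colour (hσ : ∀ x, σ (σ x) = x) (hτ : ∀ x, τ (τ x) = x)
    (hJσ : ∀ x, J x (σ x)) (hJτ : ∀ x, J x (τ x))
    (hmin : ∀ F : Setoid T, (∀ x, F x (σ x)) → (∀ x, F x (τ x)) → J ≤ F)
    (hno : ∀ x, ¬ (σ x = x ∧ τ x = x)) (c : T → Bool)
    (hcσ : ∀ x, σ x ≠ x → c x ≠ c (σ x)) (hcτ : ∀ x, τ x ≠ x → c x ≠ c (τ x))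
    (a b : T) (ha : σ a = a ∨ τ a = a) (hb : σ b = b ∨ τ b = b) (hab : J a b) (hne : a ≠ b) :
    (if σ a = a then !(c a) else c a) ≠ if σ b = b then !(c b) else c b := by
  classical
  obtain ⟨d, -, hd⟩ := two_ends hσ hτ hJσ hJτ hmin hno a ha
  have hbd := hd b ⟨hne.symm, hab, hb⟩
  let ε : T → ℤ := fun x => if c x then 1 else -1
  have hε : ∀ x y, c x ≠ c y → ε x + ε y = 0 := by
    intro x y h
    simp only [ε]
    cases hx : c x <;> cases hy : c y <;> simp_all
  have h2 := sum_ends (M := ℤ) σ τ hσ hτ (fun x => J a x)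
    (fun x hx => J.trans' hx (hJσ x)) (fun x hx => J.trans' hx (hJτ x)) ε
    (fun x hx => hε _ _ (hcσ x hx)) (fun x hx => hε _ _ (hcτ x hx))
  rw [Finset.sum_filter, Finset.sum_eq_add a b hne] at h2
  · have na := hno a
    have nb := hno b
    rw [if_pos (J.refl' a), if_pos hab] at h2
    by_cases h3 : σ a = a <;> by_cases h4 : σ b = b
    all_goals
      simp only [h3, h4, true_and, false_or, if_true, if_false, ε] at na nb ha hb h2 ⊢
      simp only [na, nb, ha, hb, if_true, if_false] at h2
      cases hx : c a <;> cases hy : c b <;> simp [hx, hy] at h2 ⊢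
  · rintro x - ⟨hxa, hxb⟩
    split_ifs with h3 h4 h5 h5
    · exact absurd ⟨h5, h4⟩ (hno x)
    · exact absurd ((hd x ⟨hxa, h3, Or.inr h4⟩).trans hbd.symm) hxb
    · exact absurd ((hd x ⟨hxa, h3, Or.inl h5⟩).trans hbd.symm) hxb
    · rfl
    · rfl
  · simp
  · simp

end TwoEnds

variable {U V W : Type}

theorem stack_props [Finite U] [Finite V] [Finite W] {C : Setoid (U ⊕ V)} {D : Setoid (V ⊕ W)}
    (hC : IsMatching C) (hD : IsMatching D) :
    IsMatching (stack C D) ∧ ∀ (cU : U → Bool) (cV : V → Bool) (cW : W → Bool),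
      IsBicoloured (Sum.elim cU fun v => !(cV v)) C →
      IsBicoloured (Sum.elim cV fun w => !(cW w)) D →
      IsBicoloured (Sum.elim cU fun w => !(cW w)) (stack C D) := by
  classical
  cases nonempty_fintype U
  cases nonempty_fintype V
  cases nonempty_fintype W
  obtain ⟨p, hp1, hp2, hp3, hp4⟩ := hC.exists_partner
  obtain ⟨q, hq1, hq2, hq3, hq4⟩ := hD.exists_partner
  have h12 : Function.Injective (incl₁₂ : U ⊕ V → U ⊕ (V ⊕ W)) :=
    Function.injective_id.sumMap Sum.inl_injective
  let σ : U ⊕ (V ⊕ W) → U ⊕ (V ⊕ W) := Sum.elim (fun u => incl₁₂ (p (Sum.inl u)))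
    (Sum.elim (fun v => incl₁₂ (p (Sum.inr v))) fun w => Sum.inr (Sum.inr w))
  let τ : U ⊕ (V ⊕ W) → U ⊕ (V ⊕ W) := Sum.elim Sum.inl fun y => Sum.inr (q y)
  have hσi : ∀ x : U ⊕ V, σ (incl₁₂ x) = incl₁₂ (p x) := by rintro (u | v) <;> rfl
  have hτi : ∀ x : V ⊕ W, τ (incl₂₃ x) = incl₂₃ (q x) := fun x => rfl
  have hσ : ∀ x, σ (σ x) = x := by
    rintro (u | v | w)
    · exact (hσi _).trans (congrArg incl₁₂ (hp1 _))
    · exact (hσi _).trans (congrArg incl₁₂ (hp1 _))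
    · rfl
  have hτ : ∀ x, τ (τ x) = x := by
    rintro (u | y)
    · rfl
    · exact congrArg Sum.inr (hq1 y)
  have hJ := le_glue C D
  have hJσ : ∀ x, glue C D x (σ x) := by
    rintro (u | v | w)
    · exact hJ.1 (hp3 (Sum.inl u))
    · exact hJ.1 (hp3 (Sum.inr v))
    · exact Setoid.refl' _ _
  have hJτ : ∀ x, glue C D x (τ x) := by
    rintro (u | y)
    · exact Setoid.refl' _ _
    · exact hJ.2 (hq3 y)
  have hmin : ∀ F : Setoid (U ⊕ (V ⊕ W)), (∀ x, F x (σ x)) → (∀ x, F x (τ x)) →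
      glue C D ≤ F := by
    intro F h1 h2
    refine glue_le_iff.2 ⟨fun x y hxy => ?_, fun x y hxy => ?_⟩
    · rcases hp4 x y hxy with rfl | rfl
      · exact Setoid.refl' _ _
      · change F (incl₁₂ x) (incl₁₂ (p x))
        rw [← hσi]
        exact h1 _
    · rcases hq4 x y hxy with rfl | rfl
      · exact Setoid.refl' _ _
      · exact h2 (incl₂₃ x)
  have hσU : ∀ u, σ (Sum.inl u) ≠ Sum.inl u := fun u h => hp2 (Sum.inl u) (h12 h)
  have hσV : ∀ v, σ (Sum.inr (Sum.inl v)) ≠ Sum.inr (Sum.inl v) :=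
    fun v h => hp2 (Sum.inr v) (h12 h)
  have hσW : ∀ w, σ (Sum.inr (Sum.inr w)) = Sum.inr (Sum.inr w) := fun w => rfl
  have hτU : ∀ u, τ (Sum.inl u) = Sum.inl u := fun u => rfl
  have hτy : ∀ y, τ (Sum.inr y) ≠ Sum.inr y := fun y h => hq2 y (Sum.inr_injective h)
  have hno : ∀ x, ¬ (σ x = x ∧ τ x = x) := by
    rintro (u | y) ⟨h1, h2⟩
    · exact hσU u h1
    · exact hτy y h2
  have hend : ∀ x, (σ x = x ∨ τ x = x) ↔ ∃ y : U ⊕ W, incl₁₃ y = x := by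
    rintro (u | v | w)
    · exact ⟨fun _ => ⟨Sum.inl u, rfl⟩, fun _ => Or.inr rfl⟩
    · constructor
      · rintro (h | h)
        · exact absurd h (hσV v)
        · exact absurd h (hτy _)
      · rintro ⟨u | w, h⟩
        · exact absurd h (by simp [incl₁₃])
        · exact absurd h (by simp [incl₁₃])
    · exact ⟨fun _ => ⟨Sum.inr w, rfl⟩, fun _ => Or.inl rfl⟩
  have h13 : Function.Injective (incl₁₃ : U ⊕ W → U ⊕ (V ⊕ W)) :=
    Function.injective_id.sumMap Sum.inr_injective
  refine ⟨fun x => ?_, fun cU cV cW h1 h2 x y hxy hne => ?_⟩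
  · obtain ⟨b, ⟨hb1, hb2, hb3⟩, hb4⟩ :=
      two_ends hσ hτ hJσ hJτ hmin hno (incl₁₃ x) ((hend _).2 ⟨x, rfl⟩)
    obtain ⟨y, rfl⟩ := (hend b).1 hb3
    refine ⟨y, ⟨fun h => hb1 (congrArg _ h), hb2⟩, ?_⟩
    rintro z ⟨hz1, hz2⟩
    exact h13 (hb4 _ ⟨fun h => hz1 (h13 h), hz2, (hend _).2 ⟨z, rfl⟩⟩)
  · let c : U ⊕ (V ⊕ W) → Bool := Sum.elim cU (Sum.elim (fun v => !(cV v)) cW)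
    have hc12 : ∀ x : U ⊕ V, c (incl₁₂ x) = Sum.elim cU (fun v => !(cV v)) x := by
      rintro (u | v) <;> rfl
    have hc23 : ∀ x : V ⊕ W, c (incl₂₃ x) = !(Sum.elim cV (fun w => !(cW w)) x) := by
      rintro (v | w)
      · rfl
      · exact (Bool.not_not _).symm
    have hcσ : ∀ x, σ x ≠ x → c x ≠ c (σ x) := by
      have : ∀ x : U ⊕ V, c (incl₁₂ x) ≠ c (σ (incl₁₂ x)) := by
        intro x
        rw [hσi, hc12, hc12]
        exact h1 _ _ (hp3 x) (hp2 x).symm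
      rintro (u | v | w) hx
      · exact this (Sum.inl u)
      · exact this (Sum.inr v)
      · exact absurd rfl hx
    have hcτ : ∀ x, τ x ≠ x → c x ≠ c (τ x) := by
      rintro (u | y) hx
      · exact absurd rfl hx
      · change c (incl₂₃ y) ≠ c (incl₂₃ (q y))
        rw [hc23, hc23]
        exact fun h => h2 _ _ (hq3 y) (hq2 y).symm (Bool.not_injective h)
    have hfin : ∀ x : U ⊕ W, (if σ (incl₁₃ x) = incl₁₃ x then !(c (incl₁₃ x))
        else c (incl₁₃ x)) = Sum.elim cU (fun w => !(cW w)) x := by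
      rintro (u | w)
      · exact if_neg (hσU u)
      · exact if_pos (hσW w)
    have := ends_colour hσ hτ hJσ hJτ hmin hno c hcσ hcτ (incl₁₃ x) (incl₁₃ y)
      ((hend _).2 ⟨x, rfl⟩) ((hend _).2 ⟨y, rfl⟩) hxy (fun h => hne (h13 h))
    rwa [hfin, hfin] at this

theorem diag_isBicoloured (c : U → Bool) :
    IsBicoloured (Sum.elim c fun u => !(c u)) (diag U) := by
  rintro (u | u) (v | v) h hne
  · have h3 : u = v := h
    exact absurd (congrArg Sum.inl h3) hne
  · have h3 : u = v := h
    simp [h3]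
  · have h3 : u = v := h
    simp [h3]
  · have h3 : u = v := h
    exact absurd (congrArg Sum.inr h3) hne

end Matching

/-! ## The categories of Brauer diagrams -/

section Brauer

open Polynomial Classical

/-- The `ℤ[T]`-linear category whose morphisms are combinations of perfect matchings of the disjoint
union of the source and the target. The composite of `C` and `D` is the matching obtained by
stacking, multiplied by `δ` to the number of closed loops and by the signs `ε`. -/
def diagramPresentation {Ob : Type} (pts : Ob → Type) [∀ X, Finite (pts X)]
    (good : ∀ X Y, Setoid (pts X ⊕ pts Y) → Prop)
    (good_diag : ∀ X, good X X (diag (pts X)))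
    (good_stack : ∀ {X Y Z} {C : Setoid (pts X ⊕ pts Y)} {D : Setoid (pts Y ⊕ pts Z)},
      good X Y C → good Y Z D → good X Z (stack C D))
    (ε : ∀ {X Y}, Setoid (pts X ⊕ pts Y) → ℤ)
    (ε_sq : ∀ {X Y} (C : Setoid (pts X ⊕ pts Y)), ε C * ε C = 1)
    (ε_diag : ∀ X, ε (diag (pts X)) = 1) (δ : ℤ[X]) :
    LinearPresentation ℤ[X] Ob where
  Basis X Y := {C : Setoid (pts X ⊕ pts Y) // good X Y C}
  basisFintype X Y := Fintype.ofFinite _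
  coeff C D E := if stack C.1 D.1 = E.1 then
    Polynomial.C (ε C.1 * ε D.1 * ε E.1) * δ ^ loops C.1 D.1 else 0
  one X := ⟨diag (pts X), good_diag X⟩
  one_coeff_self D := by
    rw [if_pos (diag_stack_aux D.1).1, (diag_stack_aux D.1).2, ε_diag, one_mul, ε_sq]
    simp
  one_coeff_ne D E h := by
    rw [if_neg]
    rw [(diag_stack_aux D.1).1]
    exact fun h' => h (Subtype.ext h')
  coeff_one_self D := by
    rw [if_pos (stack_diag_aux D.1).1, (stack_diag_aux D.1).2, ε_diag, mul_one, ε_sq]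
    simp
  coeff_one_ne D E h := by
    rw [if_neg]
    rw [(stack_diag_aux D.1).1]
    exact fun h' => h (Subtype.ext h')
  assoc A B C G := by
    rw [Finset.sum_eq_single ⟨stack A.1 B.1, good_stack A.2 B.2⟩,
      Finset.sum_eq_single ⟨stack B.1 C.1, good_stack B.2 C.2⟩]
    · obtain ⟨h1, h2⟩ := stack_assoc_aux A.1 B.1 C.1
      rw [if_pos rfl, if_pos rfl]
      simp only [h1]
      split_ifs
      · refine (mul_mul_mul_comm _ _ _ _).trans (Eq.trans ?_ (mul_mul_mul_comm _ _ _ _).symm)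
        rw [← pow_add, ← pow_add, h2, ← Polynomial.C_mul, ← Polynomial.C_mul]
        congr 2
        linear_combination (ε A.1 * ε B.1 * ε C.1 * ε G.1) *
          (ε_sq (stack A.1 B.1) - ε_sq (stack B.1 C.1))
      · simp
    · intro E _ hE
      rw [if_neg (fun h => hE (Subtype.ext h.symm)), zero_mul]
    · simp
    · intro E _ hE
      rw [if_neg (fun h => hE (Subtype.ext h.symm)), zero_mul]
    · simp

end Brauer

/-! ## Recollements -/

section Recollement

open Polynomial Classical

variable {U V W Z : Type}

/-- A recollement of `U` and `V`, up to equivalence: jointly surjective injections of `U` and `V` to a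
set are the same, up to bijection, as an equivalence relation on `U ⊔ V` (the set being the quotient)
which is trivial on `U` and on `V`. -/
def IsRecollement (C : Setoid (U ⊕ V)) : Prop :=
  (∀ a b : U, C (Sum.inl a) (Sum.inl b) → a = b) ∧ ∀ a b : V, C (Sum.inr a) (Sum.inr b) → a = b

/-- The polynomial `P^E_{C,D}(T)`: the sum of `(T - |E|)(T - |E| - 1) ⋯ (T - |F| + 1)` over the
recollements `F` of `U`, `V`, `W` inducing `C`, `D` and `E`. The size of a recollement is the number
of classes. If `C`, `D`, `E` are recollements, then such an `F` is trivial on `U`, `V` and `W`. -/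
def recollementPoly [Finite U] [Finite V] [Finite W]
    (C : Setoid (U ⊕ V)) (D : Setoid (V ⊕ W)) (E : Setoid (U ⊕ W)) : ℤ[X] :=
  letI : Fintype (Setoid (U ⊕ (V ⊕ W))) := Fintype.ofFinite _
  ∑ F : Setoid (U ⊕ (V ⊕ W)) with
      (F.comap incl₁₂ = C ∧ F.comap incl₂₃ = D ∧ F.comap incl₁₃ = E),
    ∏ i ∈ Finset.Ico (Nat.card (Quotient E)) (Nat.card (Quotient F)), (X - Polynomial.C (i : ℤ))

theorem card_range_eq {α β : Type} (φ : α → β) :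
    Nat.card (Set.range φ) = Nat.card (Quotient (Setoid.ker φ)) :=
  (Nat.card_congr (Setoid.quotientKerEquivRange φ)).symm

theorem card_extensions [Finite U] [Finite V] [Finite W] (F : Setoid (U ⊕ (V ⊕ W))) (n : ℕ)
    (f : U → Fin n) (h : W → Fin n) (hF : F.comap incl₁₃ = Setoid.ker (Sum.elim f h)) :
    (Nat.card {g : V → Fin n // Setoid.ker (Sum.elim f (Sum.elim g h)) = F} : ℤ) =
      ∏ i ∈ Finset.Ico (Nat.card (Quotient (Setoid.ker (Sum.elim f h)))) (Nat.card (Quotient F)),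
        ((n : ℤ) - i) := by
  let ι : U ⊕ W → Quotient F := fun x => Quotient.mk F (incl₁₃ x)
  have hι : Setoid.ker ι = Setoid.ker (Sum.elim f h) := by
    rw [← hF]
    ext x y
    exact ⟨fun hxy => Quotient.exact (s := F) hxy, fun hxy => Quotient.sound (s := F) hxy⟩
  let L := ↥(Set.range ι)ᶜ
  let M := ↥(Set.range (Sum.elim f h))ᶜ
  set e := Nat.card (Quotient (Setoid.ker (Sum.elim f h))) with he
  set k := Nat.card (Quotient F) with hk
  have hL : e + Nat.card L = k := by
    have := Set.ncard_add_ncard_compl (Set.range ι)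
    rw [← Nat.card_coe_set_eq, ← Nat.card_coe_set_eq, card_range_eq, hι] at this
    exact this
  have hM : e + Nat.card M = n := by
    have := Set.ncard_add_ncard_compl (Set.range (Sum.elim f h))
    rw [← Nat.card_coe_set_eq, ← Nat.card_coe_set_eq, card_range_eq] at this
    rw [Nat.card_eq_fintype_card (α := Fin n), Fintype.card_fin] at this
    exact this
  have hcard : Nat.card (L ↪ M) = (Nat.card M).descFactorial (Nat.card L) := by
    cases nonempty_fintype L
    cases nonempty_fintype M
    rw [Nat.card_eq_fintype_card, Nat.card_eq_fintype_card, Nat.card_eq_fintype_card,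
      Fintype.card_embedding_eq]
  have hbij : Nat.card {g : V → Fin n // Setoid.ker (Sum.elim f (Sum.elim g h)) = F} =
      Nat.card (L ↪ M) := by
    let lft : {g : V → Fin n // Setoid.ker (Sum.elim f (Sum.elim g h)) = F} → Quotient F → Fin n :=
      fun g => Quotient.lift (Sum.elim f (Sum.elim g.1 h)) fun a b hab => by
        have hab' : F a b := hab
        rw [← g.2] at hab'
        exact hab'
    have hlft : ∀ g, Function.Injective (lft g) := by
      intro g x y
      induction x using Quotient.inductionOn with
      | h x =>
        induction y using Quotient.inductionOn with
        | h y =>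
          intro hxy
          apply Quotient.sound
          have hab' : Setoid.ker (Sum.elim f (Sum.elim g.1 h)) x y := hxy
          rw [g.2] at hab'
          exact hab'
    have hlι : ∀ g x, lft g (ι x) = Sum.elim f h x := by
      intro g x
      rcases x with x | x <;> rfl
    refine Nat.card_eq_of_bijective (fun g => (⟨fun q => ⟨lft g q.1, ?_⟩, ?_⟩ : L ↪ M)) ⟨?_, ?_⟩
    · rintro ⟨x, hx⟩
      rw [← hlι g x] at hx
      exact q.2 ⟨x, hlft g hx⟩
    · intro q q' hqq
      exact Subtype.ext (hlft g (congrArg Subtype.val hqq))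
    · intro g g' hgg
      apply Subtype.ext
      funext v
      by_cases hq : Quotient.mk F (Sum.inr (Sum.inl v)) ∈ Set.range ι
      · obtain ⟨x, hx⟩ := hq
        have h1 := hlι g x
        have h2 := hlι g' x
        rw [hx] at h1 h2
        exact h1.trans h2.symm
      · exact congrArg Subtype.val (DFunLike.congr_fun hgg ⟨_, hq⟩)
    · intro ψ
      let ext : Quotient F → Fin n := fun q =>
        if hq : q ∈ Set.range ι then Sum.elim f h (Classical.choose hq) else (ψ ⟨q, hq⟩).1
      have hext : ∀ x, ext (ι x) = Sum.elim f h x := by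
        intro x
        have hx : ι x ∈ Set.range ι := ⟨x, rfl⟩
        simp only [ext, dif_pos hx]
        have h1 : Setoid.ker ι (Classical.choose hx) x := Classical.choose_spec hx
        rw [hι] at h1
        exact h1
      have hext' : ∀ q (hq : q ∉ Set.range ι), ext q = (ψ ⟨q, hq⟩).1 := fun q hq => dif_neg hq
      have hinj : Function.Injective ext := by
        intro q q' hqq
        by_cases h1 : q ∈ Set.range ι <;> by_cases h2 : q' ∈ Set.range ι
        · obtain ⟨x, rfl⟩ := h1
          obtain ⟨y, rfl⟩ := h2
          rw [hext, hext] at hqq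
          have h3 : Setoid.ker (Sum.elim f h) x y := hqq
          rw [← hι] at h3
          exact h3
        · obtain ⟨x, rfl⟩ := h1
          rw [hext, hext' _ h2] at hqq
          exact absurd ⟨x, hqq⟩ (ψ ⟨q', h2⟩).2
        · obtain ⟨y, rfl⟩ := h2
          rw [hext, hext' _ h1] at hqq
          exact absurd ⟨y, hqq.symm⟩ (ψ ⟨q, h1⟩).2
        · rw [hext' _ h1, hext' _ h2] at hqq
          exact congrArg Subtype.val (ψ.injective (Subtype.ext hqq))
      have hψ : Sum.elim f (Sum.elim (fun v => ext (Quotient.mk F (Sum.inr (Sum.inl v)))) h) =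
          fun x => ext (Quotient.mk F x) := by
        funext x
        rcases x with u | v | w
        · exact (hext (Sum.inl u)).symm
        · rfl
        · exact (hext (Sum.inr w)).symm
      refine ⟨⟨fun v => ext (Quotient.mk F (Sum.inr (Sum.inl v))), ?_⟩, ?_⟩
      · rw [hψ]
        ext x y
        exact ⟨fun hxy => Quotient.exact (hinj hxy), fun hxy => congrArg ext (Quotient.sound hxy)⟩
      · ext q
        obtain ⟨q, hq⟩ := q
        induction q using Quotient.inductionOn with
        | h x =>
          rcases x with u | v | w
          · exact absurd ⟨Sum.inl u, rfl⟩ hq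
          · exact congrArg Fin.val (hext' _ hq)
          · exact absurd ⟨Sum.inr w, rfl⟩ hq
  rw [hbij, hcard, ← descPochhammer_eval_eq_descFactorial ℤ, descPochhammer_eval_eq_prod_range,
    Finset.prod_Ico_eq_prod_range, ← hL, Nat.add_sub_cancel_left]
  refine Finset.prod_congr rfl fun i _ => ?_
  have : (n : ℤ) = e + Nat.card M := by exact_mod_cast hM.symm
  rw [this]
  push_cast
  ring

/-- The composition rule: for `T = n` the polynomials are the structure constants for the composition
of the equivariant maps between the spaces spanned by the injections of `U`, `V`, `W` to a set with `n`
elements. -/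
theorem sum_recollement [Finite U] [Fintype V] [Finite W] (C : Setoid (U ⊕ V)) (D : Setoid (V ⊕ W))
    (n : ℕ) (f : U → Fin n) (h : W → Fin n) :
    (∑ g : V → Fin n, if Setoid.ker (Sum.elim f g) = C ∧ Setoid.ker (Sum.elim g h) = D
      then (1 : ℤ) else 0) = (recollementPoly C D (Setoid.ker (Sum.elim f h))).eval (n : ℤ) := by
  let _ : Fintype (Setoid (U ⊕ (V ⊕ W))) := Fintype.ofFinite _
  have h1 : (recollementPoly C D (Setoid.ker (Sum.elim f h))).eval (n : ℤ) =
      ∑ F : Setoid (U ⊕ (V ⊕ W)) with (F.comap incl₁₂ = C ∧ F.comap incl₂₃ = D ∧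
        F.comap incl₁₃ = Setoid.ker (Sum.elim f h)),
        ∑ g : V → Fin n, if Setoid.ker (Sum.elim f (Sum.elim g h)) = F then (1 : ℤ) else 0 := by
    rw [recollementPoly, Polynomial.eval_finsetSum]
    refine Finset.sum_congr rfl fun F hF => ?_
    rw [Finset.sum_boole, ← Fintype.card_subtype, ← Nat.card_eq_fintype_card,
      card_extensions F n f h (Finset.mem_filter.1 hF).2.2.2, Polynomial.eval_prod]
    simp
  rw [h1, Finset.sum_comm]
  refine Finset.sum_congr rfl fun g _ => ?_
  rw [Finset.sum_ite_eq]
  simp only [Finset.mem_filter, Finset.mem_univ, true_and, comap_ker₁₂, comap_ker₂₃, comap_ker₁₃,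
    and_true]

theorem diag_isRecollement (U : Type) : IsRecollement (diag U) := ⟨fun _ _ h => h, fun _ _ h => h⟩

theorem IsRecollement.injective {γ : Type} {f : U → γ} {g : V → γ}
    (h : IsRecollement (Setoid.ker (Sum.elim f g))) :
    Function.Injective f ∧ Function.Injective g :=
  ⟨fun a b hab => h.1 a b hab, fun a b hab => h.2 a b hab⟩

theorem isRecollement_ker {γ : Type} {f : U → γ} {g : V → γ} (hf : Function.Injective f)
    (hg : Function.Injective g) : IsRecollement (Setoid.ker (Sum.elim f g)) :=
  ⟨fun _ _ hab => hf hab, fun _ _ hab => hg hab⟩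

theorem ker_eq_diag_iff {γ : Type} {f g : U → γ} (hf : Function.Injective f ∨ Function.Injective g) :
    Setoid.ker (Sum.elim f g) = diag U ↔ f = g := by
  constructor
  · intro h
    exact (diag_le_ker_iff f g).1 h.ge
  · rintro rfl
    have hf' : Function.Injective f := hf.elim id id
    ext a b
    rcases a with a | a <;> rcases b with b | b <;> exact hf'.eq_iff

theorem poly_ext_of_eval {p q : ℤ[X]} (N : ℕ) (h : ∀ n : ℕ, N ≤ n → p.eval (n : ℤ) = q.eval (n : ℤ)) :
    p = q := by
  refine Polynomial.eq_of_infinite_eval_eq p q ?_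
  refine Set.Infinite.mono (s := (fun n : ℕ => (n : ℤ)) '' Set.Ici N) ?_ ?_
  · rintro _ ⟨n, hn, rfl⟩
    exact h n hn
  · exact (Set.Ici_infinite N).image Nat.cast_injective.injOn

section

variable [Finite U] [Finite V] [Finite W] [Finite Z]

theorem diag_recollementPoly (D E : Setoid (U ⊕ V)) (hE : IsRecollement E) :
    recollementPoly (diag U) D E = if D = E then 1 else 0 := by
  cases nonempty_fintype U
  refine poly_ext_of_eval (Nat.card (U ⊕ V)) fun n hn => ?_
  obtain ⟨f, h, rfl⟩ := exists_ker E n hn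
  rw [← sum_recollement, Finset.sum_eq_single f]
  · rw [ker_eq_diag_iff (Or.inl hE.injective.1)]
    simp only [true_and, eq_comm (a := D)]
    split_ifs <;> simp
  · intro g _ hg
    rw [ker_eq_diag_iff (Or.inl hE.injective.1), if_neg]
    exact fun h' => hg h'.1.symm
  · simp

theorem recollementPoly_diag (D E : Setoid (U ⊕ V)) (hE : IsRecollement E) :
    recollementPoly D (diag V) E = if D = E then 1 else 0 := by
  cases nonempty_fintype V
  refine poly_ext_of_eval (Nat.card (U ⊕ V)) fun n hn => ?_
  obtain ⟨f, h, rfl⟩ := exists_ker E n hn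
  rw [← sum_recollement, Finset.sum_eq_single h]
  · rw [ker_eq_diag_iff (Or.inr hE.injective.2)]
    simp only [and_true, eq_comm (a := D)]
    split_ifs <;> simp
  · intro g _ hg
    rw [ker_eq_diag_iff (Or.inr hE.injective.2), if_neg]
    exact fun h' => hg h'.2
  · simp

theorem recollementPoly_assoc [Fintype {E : Setoid (U ⊕ W) // IsRecollement E}]
    [Fintype {E : Setoid (V ⊕ Z) // IsRecollement E}]
    (A : Setoid (U ⊕ V)) (B : Setoid (V ⊕ W)) (C : Setoid (W ⊕ Z)) (G : Setoid (U ⊕ Z))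
    (hA : IsRecollement A) (hC : IsRecollement C) (hG : IsRecollement G) :
    ∑ E : {E : Setoid (U ⊕ W) // IsRecollement E},
        recollementPoly A B E.1 * recollementPoly E.1 C G =
      ∑ E : {E : Setoid (V ⊕ Z) // IsRecollement E},
        recollementPoly B C E.1 * recollementPoly A E.1 G := by
  cases nonempty_fintype V
  cases nonempty_fintype W
  refine poly_ext_of_eval (Nat.card (U ⊕ Z)) fun n hn => ?_
  obtain ⟨f, k, rfl⟩ := exists_ker G n hn
  simp only [Polynomial.eval_finsetSum, Polynomial.eval_mul]
  simp only [← sum_recollement _ _ n f k, Finset.mul_sum]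
  rw [Finset.sum_comm]
  have hL : ∀ h : W → Fin n, (∑ E : {E : Setoid (U ⊕ W) // IsRecollement E},
      (recollementPoly A B E.1).eval (n : ℤ) * if Setoid.ker (Sum.elim f h) = E.1 ∧
        Setoid.ker (Sum.elim h k) = C then 1 else 0) =
      ∑ g : V → Fin n, if (Setoid.ker (Sum.elim f g) = A ∧ Setoid.ker (Sum.elim g h) = B) ∧
        Setoid.ker (Sum.elim h k) = C then 1 else 0 := by
    intro h
    by_cases hc : Setoid.ker (Sum.elim h k) = C
    · have hh : IsRecollement (Setoid.ker (Sum.elim f h)) := by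
        rw [← hc] at hC
        exact isRecollement_ker hG.injective.1 hC.injective.1
      rw [Finset.sum_eq_single ⟨_, hh⟩]
      · simp only [hc, and_true, if_true, mul_one, ← sum_recollement]
      · intro E _ hE
        rw [if_neg (fun h' => hE (Subtype.ext h'.1.symm)), mul_zero]
      · simp
    · simp [hc]
  have hR : ∀ g : V → Fin n, (∑ E : {E : Setoid (V ⊕ Z) // IsRecollement E},
      (recollementPoly B C E.1).eval (n : ℤ) * if Setoid.ker (Sum.elim f g) = A ∧
        Setoid.ker (Sum.elim g k) = E.1 then 1 else 0) =
      ∑ h : W → Fin n, if (Setoid.ker (Sum.elim f g) = A ∧ Setoid.ker (Sum.elim g h) = B) ∧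
        Setoid.ker (Sum.elim h k) = C then 1 else 0 := by
    intro g
    by_cases hc : Setoid.ker (Sum.elim f g) = A
    · have hh : IsRecollement (Setoid.ker (Sum.elim g k)) := by
        rw [← hc] at hA
        exact isRecollement_ker hA.injective.2 hG.injective.2
      rw [Finset.sum_eq_single ⟨_, hh⟩]
      · simp only [hc, true_and, if_true, mul_one, ← sum_recollement]
      · intro E _ hE
        rw [if_neg (fun h' => hE (Subtype.ext h'.2.symm)), mul_zero]
      · simp
    · simp [hc]
  simp only [hL]
  rw [Finset.sum_comm]
  conv_rhs => rw [Finset.sum_comm]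
  simp only [hR]

end

/-- A finite set, regarded as an object `[U]`. -/
structure FinSet where
  carrier : Type
  [finite : Finite carrier]

attribute [instance] FinSet.finite

/-- The recollements of two finite sets. -/
def Rec (U V : FinSet) : Type := {C : Setoid (U.carrier ⊕ V.carrier) // IsRecollement C}

instance (U V : FinSet) : Finite (Rec U V) := inferInstanceAs (Finite {_C // _})

/-- The `ℤ[T]`-linear category with objects `[U]` for finite sets `U`, in which `Hom([U], [V])` is
free on the recollements of `U` and `V`. -/
def symmetricPresentation : LinearPresentation ℤ[X] FinSet where
  Basis := Rec
  basisFintype U V := Fintype.ofFinite _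
  coeff C D E := recollementPoly C.1 D.1 E.1
  one U := ⟨diag U.carrier, diag_isRecollement _⟩
  one_coeff_self D := (diag_recollementPoly D.1 D.1 D.2).trans (if_pos rfl)
  one_coeff_ne D E h := (diag_recollementPoly D.1 E.1 E.2).trans (if_neg fun h' => h (Subtype.ext h'))
  coeff_one_self D := (recollementPoly_diag D.1 D.1 D.2).trans (if_pos rfl)
  coeff_one_ne D E h := (recollementPoly_diag D.1 E.1 E.2).trans (if_neg fun h' => h (Subtype.ext h'))
  assoc {U V W Z} A B C G := by
    let _ : Fintype {E : Setoid (U.carrier ⊕ W.carrier) // IsRecollement E} :=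
      Fintype.ofFinite (Rec U W)
    let _ : Fintype {E : Setoid (V.carrier ⊕ Z.carrier) // IsRecollement E} :=
      Fintype.ofFinite (Rec V Z)
    exact recollementPoly_assoc A.1 B.1 C.1 G.1 A.2 C.2 G.2

end Recollement

/-! ## General linear, orthogonal and symplectic groups -/

section Classical

open Polynomial

theorem stack_isMatching {U V W : Type} [Finite U] [Finite V] [Finite W] {C : Setoid (U ⊕ V)}
    {D : Setoid (V ⊕ W)} (hC : IsMatching C) (hD : IsMatching D) : IsMatching (stack C D) :=
  (stack_props hC hD).1

/-- The orthogonal case: the object `m` stands for `V^{⊗ m}`, the morphisms are the combinations of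
Brauer diagrams, and a closed loop is replaced by `T`. -/
def orthogonalPresentation : LinearPresentation ℤ[X] ℕ :=
  diagramPresentation (fun m => Fin m) (fun _ _ C => IsMatching C) (fun _ => diag_isMatching _)
    stack_isMatching (fun _ => 1) (fun _ => one_mul 1) (fun _ => rfl) X

/-- The tensor factors of `V^{⊗ p} ⊗ (V*)^{⊗ q}`. -/
abbrev Factors (x : ℕ × ℕ) : Type := Fin x.1 ⊕ Fin x.2

/-- A walled Brauer diagram: a perfect matching in which partners are of the same kind (`V` or `V*`)
if one lies in the source and the other in the target, and of opposite kinds otherwise. In other words,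
for source `(p, q)` and target `(r, s)`, a bijection from the factors `V` of the source and `V*` of the
target to the factors `V` of the target and `V*` of the source. -/
def IsWalled {x y : ℕ × ℕ} (C : Setoid (Factors x ⊕ Factors y)) : Prop :=
  IsMatching C ∧ IsBicoloured (Sum.elim Sum.isLeft fun j => !(Sum.isLeft j)) C

/-- The general linear case: the object `(p, q)` stands for `V^{⊗ p} ⊗ (V*)^{⊗ q}`, the morphisms are
the combinations of walled Brauer diagrams, and a closed loop is replaced by `T`. -/
def generalLinearPresentation : LinearPresentation ℤ[X] (ℕ × ℕ) :=
  diagramPresentation Factors (fun _ _ C => IsWalled C)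
    (fun _ => ⟨diag_isMatching _, diag_isBicoloured _⟩)
    (fun hC hD => ⟨stack_isMatching hC.1 hD.1, (stack_props hC.1 hD.1).2 _ _ _ hC.2 hD.2⟩)
    (fun _ => 1) (fun _ => one_mul 1) (fun _ => rfl) X

/-- The position of a point when one runs through the source from left to right and then through the
target from right to left. -/
def boundaryPos {m n : ℕ} : Fin m ⊕ Fin n → ℕ := Sum.elim (fun i => i) fun j => m + j.rev

/-- The number of crossings: the pairs of matched pairs `{a, c}`, `{b, d}` which separate each other on
the boundary. -/
def crossings {m n : ℕ} (C : Setoid (Fin m ⊕ Fin n)) : ℕ :=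
  Nat.card {q : (Fin m ⊕ Fin n) × (Fin m ⊕ Fin n) × (Fin m ⊕ Fin n) × (Fin m ⊕ Fin n) //
    boundaryPos q.1 < boundaryPos q.2.1 ∧ boundaryPos q.2.1 < boundaryPos q.2.2.1 ∧
      boundaryPos q.2.2.1 < boundaryPos q.2.2.2 ∧ C q.1 q.2.2.1 ∧ C q.2.1 q.2.2.2}

theorem crossings_diag (m : ℕ) : crossings (diag (Fin m)) = 0 := by
  rw [crossings, Nat.card_eq_zero]
  left
  constructor
  rintro ⟨⟨a, b, c, d⟩, h1, h2, h3, h4, h5⟩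
  have h4' : Sum.elim id id a = Sum.elim id id c := h4
  have h5' : Sum.elim id id b = Sum.elim id id d := h5
  rcases a with a | a <;> rcases b with b | b <;> rcases c with c | c <;> rcases d with d | d <;>
    simp only [boundaryPos, Sum.elim_inl, Sum.elim_inr, id, Fin.val_rev] at h1 h2 h3 h4' h5' <;>
    subst h4' <;> subst h5' <;> omega

/-- The symplectic case, with `T` the dimension of `V`: the object `m` stands for `V^{⊗ m}`. A perfect
matching `C` stands for the map given by the symplectic form `ω` on the pairs in the source, by the
inverse `ω⁻¹` of its matrix on the pairs in the target (both with the two arguments in order from left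
to right), and by the identity on the pairs joining source and target. As `ω` is alternating, a loop
`∑ ω (e_i, e_j) (ω⁻¹)_{i j}` is `-T`, exchanging the arguments of `ω` or of `ω⁻¹` gives a factor `-1`,
and the composite of `C` and `D` is the stacked diagram `E` with the factor
`(-T) ^ loops * (-1) ^ (crossings of C, D and E)`. -/
def symplecticPresentation : LinearPresentation ℤ[X] ℕ :=
  diagramPresentation (fun m => Fin m) (fun _ _ C => IsMatching C) (fun _ => diag_isMatching _)
    stack_isMatching (fun C => (-1) ^ crossings C)
    (fun C => by rw [← mul_pow]; simp) (fun m => by rw [crossings_diag, pow_zero]) (-X)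

end Classical

/-! ## Specialization and pseudo-abelian envelopes -/

section Envelopes

open Polynomial

/-- Specialization `T ↦ t`. -/
def LinearPresentation.specialize {Ob : Type*} (P : LinearPresentation ℤ[X] Ob) {R : Type*}
    [CommRing R] (t : R) : LinearPresentation R Ob :=
  P.map (Polynomial.eval₂RingHom (Int.castRingHom R) t)

/-- The pseudo-abelian envelope: the Karoubi envelope of the additive envelope. -/
abbrev PsAb (C : Type*) [Category C] [Preadditive C] := Idempotents.Karoubi (Mat_ C)

/-- The category `Rep(S_t, R)`. -/
abbrev RepS (R : Type*) [CommRing R] (t : R) := PsAb (symmetricPresentation.specialize t).Cat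

/-- The category `Rep(S_t, R)^{(N)}`, built from the `[U]` with `|U| ≤ N`. -/
abbrev RepSLE (R : Type*) [CommRing R] (t : R) (N : ℕ) :=
  PsAb (ObjectProperty.FullSubcategory fun X : (symmetricPresentation.specialize t).Cat =>
    Nat.card X.ob.carrier ≤ N)

/-- The category `Rep(GL_t, R)`. -/
abbrev RepGL (R : Type*) [CommRing R] (t : R) := PsAb (generalLinearPresentation.specialize t).Cat

/-- The part of `Rep(GL_t, R)` built from the `V^{⊗ p} ⊗ (V*)^{⊗ q}` with `p + q ≤ N`. -/
abbrev RepGLLE (R : Type*) [CommRing R] (t : R) (N : ℕ) :=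
  PsAb (ObjectProperty.FullSubcategory fun X : (generalLinearPresentation.specialize t).Cat =>
    X.ob.1 + X.ob.2 ≤ N)

/-- The category `Rep(O_t, R)`. -/
abbrev RepO (R : Type*) [CommRing R] (t : R) := PsAb (orthogonalPresentation.specialize t).Cat

/-- The part of `Rep(O_t, R)` built from the `V^{⊗ m}` with `m ≤ N`. -/
abbrev RepOLE (R : Type*) [CommRing R] (t : R) (N : ℕ) :=
  PsAb (ObjectProperty.FullSubcategory fun X : (orthogonalPresentation.specialize t).Cat => X.ob ≤ N)

/-- The category `Rep(Sp_t, R)`, where `t` is the dimension of `V`. -/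
abbrev RepSp (R : Type*) [CommRing R] (t : R) := PsAb (symplecticPresentation.specialize t).Cat

/-- The part of `Rep(Sp_t, R)` built from the `V^{⊗ m}` with `m ≤ N`. -/
abbrev RepSpLE (R : Type*) [CommRing R] (t : R) (N : ℕ) :=
  PsAb (ObjectProperty.FullSubcategory fun X : (symplecticPresentation.specialize t).Cat => X.ob ≤ N)

/-- A preadditive category is semisimple abelian if it is abelian (with the given addition of
morphisms) and every object is a finite direct sum of simple objects. -/
structure IsSemisimpleAbelian (C : Type*) [Category C] [P : Preadditive C] : Prop where
  abelian : ∃ A : Abelian C, A.toPreadditive = P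
  semisimple : ∀ X : C, ∃ (n : ℕ) (S : Fin n → C) (b : Limits.Bicone S),
    (∀ i, Simple (S i)) ∧ Nonempty b.IsBilimit ∧ Nonempty (X ≅ b.pt)

end Envelopes

end

end DeligneCat

open DeligneCat

/-! For a finite family `Y` of objects, the endomorphism algebra of their formal direct sum is free
of finite rank over `ℤ[X]`, with a basis of matrix units, and this description commutes with every
specialization `T ↦ t`. The Gram determinant of the trace form of its left regular representation is
therefore one polynomial `d` with integer coefficients, whose value at `t` is the corresponding
determinant at `t` (`traceGram_endBasis_map`). If `d(t) ≠ 0`, the trace form is nondegenerate;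
elements of the Jacobson radical have nilpotent multiples and so lie in its kernel, and the algebra
is semisimple (`isSemisimpleRing_of_trace`). The exceptional parameters of the family are thus among
the roots of `d`, hence finite in number and algebraic, provided that `d ≠ 0`.

For `d ≠ 0` one integral parameter suffices (`HasTransposeRep.exists_discriminant`). There the
diagrams act faithfully by real matrices whose span is closed under transposition, and then the
regular trace of `x xᵀ` is a sum of squares that vanishes only for `x = 0`
(`trace_nondegenerate_of_transpose`). In the symmetric case the parameter is a large `n`, and
recollements act on functions of `n`-colourings. In the other cases matchings act on tensor powers
of `ℝⁿ` with its orthonormal basis, at `T = n` for `O` and `GL` and at `T = -n` for `Sp`. Once `n`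
is at least the number of points of any diagram involved, some colouring has a prescribed diagram as
its kernel, which makes the action faithful.

It remains to pass from algebras to categories. If every object in question is a summand of a power
of an object with semisimple endomorphism ring, then each morphism `f` has a `g` with `f g f = f`
(`exists_generalized_inverse`). After idempotents are split, such a category has kernels and
cokernels, and all its monomorphisms and epimorphisms split, so it is abelian; finite-dimensional
morphism spaces then give decompositions into simple objects
(`IsRegularCategory.isSemisimpleAbelian`). The part of level `N` has one finite generating family
valid for all `t`, hence one `d`. In the whole category each pair of objects has its own `d`, and a
transcendental `t` is a root of none. -/

namespace DeligneCat

noncomputable section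

/-! ### Trace forms, discriminants and semisimple algebras -/

section TraceForm

open Module

/-- The trace of the left regular representation. -/
def regularTrace (R A : Type*) [CommRing R] [Ring A] [Algebra R A] : A →ₗ[R] R :=
  LinearMap.trace R A ∘ₗ (Algebra.lmul R A).toLinearMap

theorem regularTrace_eq_sum {R A ι : Type*} [CommRing R] [Ring A] [Algebra R A] [Fintype ι]
    (b : Basis ι R A) (x : A) : regularTrace R A x = ∑ i, b.repr (x * b i) i := by
  classical
  simp [regularTrace, LinearMap.trace_eq_matrix_trace R b, Matrix.trace, LinearMap.toMatrix_apply]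

/-- The Gram matrix of the trace form of the left regular representation. -/
def traceGram (R : Type*) {A ι : Type*} [CommRing R] [Ring A] [Algebra R A] (b : ι → A) :
    Matrix ι ι R :=
  Matrix.of fun i j => regularTrace R A (b i * b j)

/-- In coordinates, the left kernel of the Gram matrix is the left radical of the trace form. -/
theorem traceGram_det_ne_zero_iff {K A ι : Type*} [Field K] [Ring A] [Algebra K A] [Fintype ι]
    [DecidableEq ι] (b : Basis ι K A) :
    (traceGram K b).det ≠ 0 ↔ ∀ x : A, (∀ y, regularTrace K A (x * y) = 0) → x = 0 := by
  have key : ∀ (v : ι → K) (j : ι), Matrix.vecMul v (traceGram K b) j =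
      regularTrace K A ((∑ i, v i • b i) * b j) := by
    intro v j
    simp [Matrix.vecMul, dotProduct, traceGram, Finset.sum_mul, map_sum]
  constructor
  · intro h x hx
    have h0 : Matrix.vecMul (b.repr x) (traceGram K b) = 0 := by
      funext j
      rw [key, b.sum_repr, hx, Pi.zero_apply]
    have h1 := Matrix.eq_zero_of_vecMul_eq_zero h h0
    exact b.repr.map_eq_zero_iff.1 (DFunLike.coe_injective h1)
  · intro h h0
    obtain ⟨v, hv, hv0⟩ := Matrix.exists_vecMul_eq_zero_iff.2 h0
    have h1 : ∑ i, v i • b i = 0 := by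
      refine h _ fun y => ?_
      rw [← b.sum_repr y, Finset.mul_sum, map_sum]
      refine Finset.sum_eq_zero fun j _ => ?_
      rw [mul_smul_comm, map_smul, ← key, hv0, Pi.zero_apply, smul_zero]
    exact hv (funext (Fintype.linearIndependent_iff.1 b.linearIndependent v h1))

/-- The regular trace of a product of basis elements is a polynomial expression in the structure
constants, and a semilinear ring homomorphism carrying basis to basis carries structure constants to
structure constants. -/
theorem traceGram_map {R S A B ι : Type*} [CommRing R] [CommRing S] [Ring A] [Ring B]
    [Algebra R A] [Algebra S B] [Fintype ι] (φ : R →+* S) (ψ : A →+* B)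
    (hψ : ∀ (r : R) (a : A), ψ (r • a) = φ r • ψ a) (b : Basis ι R A) (b' : Basis ι S B)
    (hb : ∀ i, ψ (b i) = b' i) : (traceGram R b).map φ = traceGram S b' := by
  classical
  have hrepr : ∀ a k, b'.repr (ψ a) k = φ (b.repr a k) := by
    intro a k
    conv_lhs => rw [← b.sum_repr a]
    simp only [map_sum, hψ, hb, Finsupp.coe_finsetSum, Finset.sum_apply, map_smul, b'.repr_self,
      Finsupp.smul_apply, smul_eq_mul, Finsupp.single_apply]
    simp
  ext i j
  simp only [Matrix.map_apply, traceGram, Matrix.of_apply, regularTrace_eq_sum b,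
    regularTrace_eq_sum b', map_sum]
  refine Finset.sum_congr rfl fun k _ => ?_
  rw [← hrepr, ψ.map_mul, ψ.map_mul, hb, hb, hb]

/-- The Jacobson radical of an Artinian ring is a nilpotent ideal. For `x` in it every `x * y` is
nilpotent and acts with trace zero, so nondegeneracy forces `x = 0`. -/
theorem isSemisimpleRing_of_trace {K A : Type*} [Field K] [Ring A] [Algebra K A]
    [FiniteDimensional K A] (h : ∀ x : A, (∀ y, regularTrace K A (x * y) = 0) → x = 0) :
    IsSemisimpleRing A := by
  have : IsArtinianRing A := IsArtinianRing.of_finite K A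
  rw [IsArtinianRing.isSemisimpleRing_iff_jacobson]
  rw [eq_bot_iff]
  intro x hx
  refine h x fun y => ?_
  have hxy : x * y ∈ Ring.jacobson A := Ideal.mul_mem_right _ _ hx
  obtain ⟨n, hn⟩ := IsArtinianRing.isNilpotent_jacobson_bot (R := A)
  have hnil : IsNilpotent (x * y) := by
    refine ⟨n, ?_⟩
    have : (x * y) ^ n ∈ (Ideal.jacobson (⊥ : Ideal A)) ^ n :=
      Ideal.pow_mem_pow (by rwa [Ideal.jacobson_bot]) n
    rw [hn] at this
    exact this
  exact (LinearMap.isNilpotent_trace_of_isNilpotent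
    (hnil.map (Algebra.lmul K A))).eq_zero

/-- The left ideal of `f` is generated by an idempotent `e = g * f`, and `f`, being a left multiple
of `e`, satisfies `f * e = f`. -/
theorem IsSemisimpleRing.exists_mul_mul_eq {A : Type*} [Ring A] [IsSemisimpleRing A] (f : A) :
    ∃ g, f * g * f = f := by
  obtain ⟨e, he, hs⟩ := IsSemisimpleRing.ideal_eq_span_idempotent (Ideal.span {f})
  have h1 : e ∈ Ideal.span {f} := by rw [hs]; exact Ideal.subset_span rfl
  have h2 : f ∈ Ideal.span {e} := by rw [← hs]; exact Ideal.subset_span rfl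
  obtain ⟨g, rfl⟩ := Ideal.mem_span_singleton'.1 h1
  obtain ⟨k, hk⟩ := Ideal.mem_span_singleton'.1 h2
  refine ⟨g, ?_⟩
  rw [mul_assoc]
  conv_lhs => rw [← hk, mul_assoc]
  rw [hk, he.eq, hk]

/-- A real algebra with a faithful matrix representation whose image is closed under
transposition has a nondegenerate trace form. -/
theorem trace_nondegenerate_of_transpose {A S : Type*} [Ring A] [Algebra ℝ A]
    [FiniteDimensional ℝ A] [Fintype S] (ρ : A →ₗ[ℝ] Matrix S S ℝ)
    (hρ : Function.Injective ρ) (hmul : ∀ x y, ρ (x * y) = ρ x * ρ y)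
    (htr : ∀ x, ∃ y, ρ y = (ρ x).transpose) (x : A)
    (hx : ∀ y, regularTrace ℝ A (x * y) = 0) : x = 0 := by
  obtain ⟨y, hy⟩ := htr x
  -- The embedding transports the Hilbert–Schmidt inner product `tr (aᵀ b)` to `A`.
  let i : A →ₗ[ℝ] EuclideanSpace ℝ (S × S) :=
    { toFun := fun a => WithLp.toLp 2 fun p => ρ a p.1 p.2
      map_add' := fun a b => by ext p; simp
      map_smul' := fun r a => by ext p; simp }
  have hi : Function.Injective i := by
    intro a b hab
    apply hρ
    ext s t
    exact congrArg (fun v : EuclideanSpace ℝ (S × S) => v (s, t)) hab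
  let e := LinearEquiv.ofInjective i hi
  have hinner : ∀ a b, inner ℝ (i a) (i b) = ((ρ a).transpose * ρ b).trace := by
    intro a b
    simp only [PiLp.inner_apply, i, Matrix.trace, Matrix.diag, Matrix.mul_apply,
      Matrix.transpose_apply, Fintype.sum_prod_type]
    rw [Finset.sum_comm]
    simp [mul_comm]
  -- As `y` represents the transpose of `x`, both sides are `tr (aᵀ x xᵀ a)`. The trace of
  -- multiplication by `x * y`, computed in an orthonormal basis, is therefore a sum of squared
  -- norms of the products of `y` with the basis vectors.
  have key : ∀ a, inner ℝ (i a) (i (x * y * a)) = inner ℝ (i (y * a)) (i (y * a)) := by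
    intro a
    rw [hinner, hinner, hmul, hmul, hmul, hy, Matrix.transpose_mul, Matrix.transpose_transpose]
    simp only [Matrix.mul_assoc]
  have htr0 := hx y
  let o := stdOrthonormalBasis ℝ (LinearMap.range i)
  have h1 : regularTrace ℝ A (x * y) =
      ∑ k, inner ℝ (i (y * e.symm (o k))) (i (y * e.symm (o k))) := by
    change LinearMap.trace ℝ A (Algebra.lmul ℝ A (x * y)) = _
    rw [← LinearMap.trace_conj' (Algebra.lmul ℝ A (x * y)) e, LinearMap.trace_eq_sum_inner _ o]
    refine Finset.sum_congr rfl fun k _ => ?_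
    rw [← key, Submodule.coe_inner]
    have h2 : i (e.symm (o k)) = o k := congrArg Subtype.val (e.apply_symm_apply (o k))
    rw [h2]
    rfl
  rw [h1, Finset.sum_eq_zero_iff_of_nonneg fun k _ => real_inner_self_nonneg] at htr0
  have h3 : ∀ k, y * e.symm (o k) = 0 := fun k =>
    hi ((inner_self_eq_zero (𝕜 := ℝ)).1 (htr0 k (Finset.mem_univ k)) |>.trans (map_zero i).symm)
  have h4 : (LinearMap.mulLeft ℝ y) ∘ₗ e.symm.toLinearMap = 0 :=
    o.toBasis.ext fun k => by simpa using h3 k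
  -- Multiplication by `y` vanishes on all of `A`, in particular on `1`. The unit is used in `A`
  -- only, so `ρ` need not send it to the identity matrix.
  have h5 : y = 0 := by
    have := LinearMap.congr_fun h4 (e 1)
    simpa using this
  apply hρ
  rw [map_zero, ← Matrix.transpose_transpose (ρ x), ← hy, h5, map_zero, Matrix.transpose_zero]

end TraceForm

/-! ### Von Neumann regular categories are semisimple abelian -/

section Regular

open Limits

/-- Every morphism has a generalized inverse. -/
def IsRegularCategory (D : Type*) [Category D] : Prop :=
  ∀ ⦃X Y : D⦄ (f : X ⟶ Y), ∃ g : Y ⟶ X, f ≫ g ≫ f = f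

variable {D : Type*} [Category D]

theorem exists_splitting [IsIdempotentComplete D] {X : D} (e : X ⟶ X) (he : e ≫ e = e) :
    ∃ (Y : D) (i : Y ⟶ X) (p : X ⟶ Y), i ≫ p = 𝟙 Y ∧ p ≫ i = e :=
  IsIdempotentComplete.idempotents_split X e he

theorem IsRegularCategory.exists_retraction (hD : IsRegularCategory D) {X Y : D} (f : X ⟶ Y)
    [Mono f] : ∃ g, f ≫ g = 𝟙 X := by
  obtain ⟨g, hg⟩ := hD f
  exact ⟨g, by rw [← cancel_mono f, Category.assoc, hg, Category.id_comp]⟩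

theorem IsRegularCategory.exists_section (hD : IsRegularCategory D) {X Y : D} (f : X ⟶ Y)
    [Epi f] : ∃ g, g ≫ f = 𝟙 Y := by
  obtain ⟨g, hg⟩ := hD f
  exact ⟨g, by rw [← cancel_epi f, hg, Category.comp_id]⟩

/-- Compressing a generalized inverse by the two idempotents changes nothing, because `f` already
absorbs them. -/
theorem IsRegularCategory.karoubi (hD : IsRegularCategory D) :
    IsRegularCategory (Idempotents.Karoubi D) := by
  intro P Q f
  obtain ⟨g, hg⟩ := hD f.f
  refine ⟨⟨Q.p ≫ g ≫ P.p, by simp⟩, ?_⟩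
  ext
  simpa using hg

variable [Preadditive D]

/-- With `f ≫ g ≫ f = f`, the endomorphism `𝟙 - f ≫ g` is idempotent, and its image is the kernel of
`f`. -/
theorem IsRegularCategory.hasKernels [IsIdempotentComplete D] (hD : IsRegularCategory D) :
    HasKernels D where
  has_limit {X Y} f := by
    obtain ⟨g, hg⟩ := hD f
    obtain ⟨K, i, p, h1, h2⟩ := exists_splitting (𝟙 X - f ≫ g) (by
      simp [Preadditive.sub_comp, Preadditive.comp_sub, reassoc_of% hg])
    have hi : i ≫ f = 0 := by
      have : (p ≫ i) ≫ f = 0 := by rw [h2]; simp [Preadditive.sub_comp, hg]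
      calc i ≫ f = (i ≫ p) ≫ i ≫ f := by rw [h1, Category.id_comp]
        _ = 0 := by rw [Category.assoc, ← Category.assoc p, this, comp_zero]
    refine ⟨⟨KernelFork.ofι i hi, KernelFork.IsLimit.ofι i hi (fun k _ => k ≫ p) ?_ ?_⟩⟩
    · intro W k hk
      rw [Category.assoc, h2, Preadditive.comp_sub, Category.comp_id, ← Category.assoc, hk,
        zero_comp, sub_zero]
    · intro W k hk m hm
      rw [← hm, Category.assoc, h1, Category.comp_id]

/-- Dually, the image of the idempotent `𝟙 - g ≫ f` is the cokernel of `f`. -/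
theorem IsRegularCategory.hasCokernels [IsIdempotentComplete D] (hD : IsRegularCategory D) :
    HasCokernels D where
  has_colimit {X Y} f := by
    obtain ⟨g, hg⟩ := hD f
    obtain ⟨K, i, p, h1, h2⟩ := exists_splitting (𝟙 Y - g ≫ f) (by
      simp [Preadditive.sub_comp, Preadditive.comp_sub, hg])
    have hp : f ≫ p = 0 := by
      have : f ≫ p ≫ i = 0 := by rw [h2]; simp [Preadditive.comp_sub, hg]
      calc f ≫ p = f ≫ p ≫ i ≫ p := by rw [h1, Category.comp_id]
        _ = (f ≫ p ≫ i) ≫ p := by simp only [Category.assoc]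
        _ = 0 := by rw [this, zero_comp]
    refine ⟨⟨CokernelCofork.ofπ p hp, CokernelCofork.IsColimit.ofπ p hp (fun k _ => i ≫ k) ?_ ?_⟩⟩
    · intro W k hk
      rw [← Category.assoc, h2, Preadditive.sub_comp, Category.id_comp, Category.assoc, hk,
        comp_zero, sub_zero]
    · intro W k hk m hm
      rw [← hm, ← Category.assoc, h1, Category.id_comp]

/-- A regular idempotent complete additive category is abelian. -/
@[reducible]
def IsRegularCategory.abelian [IsIdempotentComplete D] [HasFiniteBiproducts D]
    (hD : IsRegularCategory D) : Abelian D where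
  -- A split monomorphism with retraction `g` is the kernel of the complementary idempotent `𝟙 - g ≫
  -- f`; the epimorphisms below are treated dually.
  normalMonoOfMono {X Y} f _ := by
    obtain ⟨g, hg⟩ := hD.exists_retraction f
    exact ⟨{
      Z := Y
      g := 𝟙 Y - g ≫ f
      w := by rw [Preadditive.comp_sub, ← Category.assoc, hg]; simp
      isLimit := KernelFork.IsLimit.ofι _ _ (fun k _ => k ≫ g)
        (fun k hk => by
          rw [Preadditive.comp_sub, Category.comp_id, sub_eq_zero] at hk
          rw [Category.assoc, ← hk])
        (fun k _ m hm => by rw [← hm, Category.assoc, hg, Category.comp_id]) }⟩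
  normalEpiOfEpi {X Y} f _ := by
    obtain ⟨g, hg⟩ := hD.exists_section f
    exact ⟨{
      W := X
      g := 𝟙 X - f ≫ g
      w := by rw [Preadditive.sub_comp, Category.assoc, hg]; simp
      isColimit := CokernelCofork.IsColimit.ofπ _ _ (fun k _ => g ≫ k)
        (fun k hk => by
          rw [Preadditive.sub_comp, Category.id_comp, sub_eq_zero] at hk
          rw [← Category.assoc, ← hk])
        (fun k _ m hm => by rw [← hm, ← Category.assoc, hg, Category.id_comp]) }⟩
  has_finite_products := inferInstance
  has_kernels := hD.hasKernels
  has_cokernels := hD.hasCokernels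

/-- `X` is a direct sum of finitely many simple objects. -/
def IsSumOfSimples (X : D) : Prop :=
  ∃ (n : ℕ) (S : Fin n → D) (b : Bicone S),
    (∀ i, Simple (S i)) ∧ Nonempty b.IsBilimit ∧ Nonempty (X ≅ b.pt)

theorem isSumOfSimples_of_maps {X : D} {ι : Type*} [Finite ι] (S : ι → D)
    (hS : ∀ i, Simple (S i)) (a : ∀ i, S i ⟶ X) (p : ∀ i, X ⟶ S i) (h1 : ∀ i, a i ≫ p i = 𝟙 _)
    (h2 : ∀ i j, i ≠ j → a i ≫ p j = 0) (h3 : ∑ᶠ i, p i ≫ a i = 𝟙 X) : IsSumOfSimples X := by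
  classical
  cases nonempty_fintype ι
  let e := (Fintype.equivFin ι).symm
  let b : Bicone fun k => S (e k) :=
    { pt := X
      π := fun k => p (e k)
      ι := fun k => a (e k)
      ι_π := fun j k => by
        split_ifs with h
        · subst h; simp [h1]
        · exact h2 _ _ fun h' => h (e.injective h') }
  refine ⟨_, _, b, fun k => hS _, ⟨isBilimitOfTotal b ?_⟩, ⟨Iso.refl _⟩⟩
  rw [← h3, finsum_eq_sum_of_fintype]
  exact e.sum_comp fun i => p i ≫ a i

theorem IsSumOfSimples.exists_maps {X : D} (h : IsSumOfSimples X) :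
    ∃ (n : ℕ) (S : Fin n → D) (a : ∀ i, S i ⟶ X) (p : ∀ i, X ⟶ S i), (∀ i, Simple (S i)) ∧
      (∀ i, a i ≫ p i = 𝟙 _) ∧ (∀ i j, i ≠ j → a i ≫ p j = 0) ∧ ∑ i, p i ≫ a i = 𝟙 X := by
  obtain ⟨n, S, b, hS, ⟨hb⟩, ⟨e⟩⟩ := h
  refine ⟨n, S, fun i => b.ι i ≫ e.inv, fun i => e.hom ≫ b.π i, hS, fun i => by simp,
    fun i j hij => by simp [b.ι_π, hij], ?_⟩
  have := IsBilimit.total hb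
  calc _ = e.hom ≫ (∑ i, b.π i ≫ b.ι i) ≫ e.inv := by
        simp [Preadditive.sum_comp, Preadditive.comp_sum]
    _ = 𝟙 X := by rw [this]; simp

theorem IsSumOfSimples.of_splitting {X Y Z : D} (hY : IsSumOfSimples Y) (hZ : IsSumOfSimples Z)
    (i : Y ⟶ X) (p : X ⟶ Y) (j : Z ⟶ X) (q : X ⟶ Z) (h1 : i ≫ p = 𝟙 Y) (h2 : j ≫ q = 𝟙 Z)
    (h3 : p ≫ i + q ≫ j = 𝟙 X) : IsSumOfSimples X := by
  -- Composing `h3` with `i` on one side and `q` on the other gives `i ≫ q + i ≫ q = i ≫ q`, so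
  -- orthogonality need not be assumed.
  have hpj : i ≫ q = 0 := by
    have : i ≫ (p ≫ i + q ≫ j) ≫ q = i ≫ q := by rw [h3, Category.id_comp]
    simpa [Preadditive.add_comp, Preadditive.comp_add, h2, reassoc_of% h1] using this
  have hqi : j ≫ p = 0 := by
    have : j ≫ (p ≫ i + q ≫ j) ≫ p = j ≫ p := by rw [h3, Category.id_comp]
    simpa [Preadditive.add_comp, Preadditive.comp_add, h1, reassoc_of% h2] using this
  obtain ⟨n, S, a, b, hS, ha1, ha2, ha3⟩ := hY.exists_maps
  obtain ⟨m, T, c, d, hT, hc1, hc2, hc3⟩ := hZ.exists_maps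
  refine isSumOfSimples_of_maps (ι := Fin n ⊕ Fin m) (Sum.elim S T) (Sum.rec hS hT)
    (Sum.rec (fun k => a k ≫ i) fun k => c k ≫ j) (Sum.rec (fun k => p ≫ b k) fun k => q ≫ d k)
    ?_ ?_ ?_
  · rintro (k | k)
    · simp [reassoc_of% h1, ha1]
    · simp [reassoc_of% h2, hc1]
  · rintro (k | k) (l | l) hkl
    · simp [reassoc_of% h1, ha2 k l fun h => hkl (congrArg _ h)]
      rfl
    · simp [reassoc_of% hpj]
      rfl
    · simp [reassoc_of% hqi]
      rfl
    · simp [reassoc_of% h2, hc2 k l fun h => hkl (congrArg _ h)]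
      rfl
  · rw [finsum_eq_sum_of_fintype, Fintype.sum_sum_type, ← h3]
    congr 1
    · calc _ = p ≫ (∑ k, b k ≫ a k) ≫ i := by simp [Preadditive.sum_comp, Preadditive.comp_sum]
        _ = _ := by rw [ha3, Category.id_comp]
    · calc _ = q ≫ (∑ k, d k ≫ c k) ≫ j := by simp [Preadditive.sum_comp, Preadditive.comp_sum]
        _ = _ := by rw [hc3, Category.id_comp]

open Module in
-- The map `f ↦ p ≫ f ≫ i` identifies `End Y` with the corner of `End X` cut out by the idempotent
-- `p ≫ i`. Equal dimensions would put `𝟙 X` into this corner and force `p ≫ i = 𝟙 X`.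
theorem finrank_end_lt_of_retract (K : Type*) [Field K] [Linear K D]
    [∀ X Y : D, FiniteDimensional K (X ⟶ Y)] {X Y : D} (i : Y ⟶ X) (p : X ⟶ Y)
    (h : i ≫ p = 𝟙 Y) (hne : p ≫ i ≠ 𝟙 X) : finrank K (Y ⟶ Y) < finrank K (X ⟶ X) := by
  let φ : (Y ⟶ Y) →ₗ[K] (X ⟶ X) := Linear.rightComp K X i ∘ₗ Linear.leftComp K Y p
  have hφ : ∀ f, φ f = (p ≫ f) ≫ i := fun f => rfl
  have hinj : Function.Injective φ := by
    intro f g hfg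
    have := congrArg (fun k => i ≫ k ≫ p) hfg
    simpa [hφ, h, reassoc_of% h] using this
  refine lt_of_le_of_ne (LinearMap.finrank_le_finrank_of_injective hinj) fun heq => hne ?_
  obtain ⟨f, hf⟩ := (LinearMap.injective_iff_surjective_of_finrank_eq_finrank heq).1 hinj (𝟙 X)
  have h2 := hf
  rw [hφ] at h2
  calc p ≫ i = (p ≫ i) ≫ ((p ≫ f) ≫ i) := by rw [h2, Category.comp_id]
    _ = (p ≫ f) ≫ i := by simp [reassoc_of% h]
    _ = 𝟙 X := h2

open Module in
-- Induction on the dimension of `End X`. A nonzero object that is not simple has a nonzero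
-- monomorphism into it that is not an isomorphism. It splits, and both its source and the
-- complement have smaller endomorphism algebras.
theorem IsRegularCategory.isSumOfSimples (K : Type*) [Field K] [Linear K D]
    [∀ X Y : D, FiniteDimensional K (X ⟶ Y)] [IsIdempotentComplete D]
    (hD : IsRegularCategory D) (n : ℕ) (X : D) (hX : finrank K (X ⟶ X) ≤ n) :
    IsSumOfSimples X := by
  induction n using Nat.strong_induction_on generalizing X with
  | _ n ih =>
  by_cases h0 : 𝟙 X = 0
  · exact isSumOfSimples_of_maps (ι := Empty) Empty.rec Empty.rec Empty.rec Empty.rec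
      (fun i => i.elim) (fun i => i.elim) (by rw [h0, finsum_of_isEmpty])
  by_cases hs : Simple X
  · exact isSumOfSimples_of_maps (ι := Unit) (fun _ => X) (fun _ => hs) (fun _ => 𝟙 X)
      (fun _ => 𝟙 X) (by simp) (fun i j h => absurd rfl h) (by simp [finsum_eq_sum_of_fintype])
  have : ∃ (Y : D) (f : Y ⟶ X), Mono f ∧ ¬ (IsIso f ↔ f ≠ 0) := by
    by_contra hc
    push Not at hc
    exact hs ⟨fun {Y} f hf => hc Y f hf⟩
  obtain ⟨Y, f, hf, hiso⟩ := this
  obtain ⟨g, hg⟩ := hD.exists_retraction f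
  -- The equivalence defining simplicity could also fail for an `f` that is both invertible and
  -- zero; `𝟙 X ≠ 0` excludes this.
  have hfi : IsIso f → f ≠ 0 := by
    rintro h rfl
    exact h0 (by rw [← IsIso.inv_hom_id (0 : Y ⟶ X), comp_zero])
  have hf0 : f ≠ 0 ∧ ¬ IsIso f := by tauto
  have hgf : g ≫ f ≠ 𝟙 X := fun h => hf0.2 ⟨g, hg, h⟩
  obtain ⟨Z, j, q, h1, h2⟩ := exists_splitting (𝟙 X - g ≫ f) (by
      simp [Preadditive.sub_comp, Preadditive.comp_sub, reassoc_of% hg])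
  have hqj : q ≫ j ≠ 𝟙 X := by
    rw [h2]
    intro h
    have h3 : g ≫ f = 0 := by simpa using h
    exact hf0.1 (by rw [← Category.id_comp f, ← hg, Category.assoc, h3, comp_zero])
  exact (ih _ ((finrank_end_lt_of_retract K f g hg hgf).trans_le hX) Y le_rfl).of_splitting
    (ih _ ((finrank_end_lt_of_retract K j q h1 hqj).trans_le hX) Z le_rfl) f g j q hg h1
    (by rw [h2]; abel)

theorem IsRegularCategory.isSemisimpleAbelian (K : Type*) [Field K] [Linear K D]
    [∀ X Y : D, FiniteDimensional K (X ⟶ Y)] [IsIdempotentComplete D] [HasFiniteBiproducts D]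
    (hD : IsRegularCategory D) : IsSemisimpleAbelian D where
  abelian := ⟨hD.abelian, rfl⟩
  semisimple X := hD.isSumOfSimples K _ X le_rfl

end Regular

/-! ### Generators with semisimple endomorphism ring -/

section Generators

/-- `X` is a direct summand of a finite power of `Y`. -/
def IsSummandOfPower {D : Type*} [Category D] [Preadditive D] (Y X : D) : Prop :=
  ∃ (n : ℕ) (a : Fin n → (X ⟶ Y)) (b : Fin n → (Y ⟶ X)), ∑ i, a i ≫ b i = 𝟙 X

variable {D : Type*} [Category D] [Preadditive D] {Y : D}

theorem isSummandOfPower_of_sum {X : D} {ι : Type*} [Fintype ι] (a : ι → (X ⟶ Y))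
    (b : ι → (Y ⟶ X)) (h : ∑ i, a i ≫ b i = 𝟙 X) : IsSummandOfPower Y X :=
  ⟨_, a ∘ (Fintype.equivFin ι).symm, b ∘ (Fintype.equivFin ι).symm, by
    rw [← h]; exact (Fintype.equivFin ι).symm.sum_comp fun i => a i ≫ b i⟩

/-- A morphism between summands of powers of `Y` is encoded by a matrix over `End Y`. Matrix rings
over a semisimple ring are semisimple, so this matrix has a generalized inverse, which is
transported back to a morphism. -/
theorem exists_generalized_inverse [IsSemisimpleRing (End Y)] {X Z : D}
    (hX : IsSummandOfPower Y X) (hZ : IsSummandOfPower Y Z) (f : X ⟶ Z) :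
    ∃ g : Z ⟶ X, f ≫ g ≫ f = f := by
  obtain ⟨n, a, b, hab⟩ := hX
  obtain ⟨m, c, d, hcd⟩ := hZ
  -- Padding with zeros indexes the data of `X` and of `Z` by the same set, so that `f` becomes a
  -- square matrix.
  let a' : Fin n ⊕ Fin m → (X ⟶ Y) := Sum.elim a 0
  let b' : Fin n ⊕ Fin m → (Y ⟶ X) := Sum.elim b 0
  let c' : Fin n ⊕ Fin m → (Z ⟶ Y) := Sum.elim 0 c
  let d' : Fin n ⊕ Fin m → (Y ⟶ Z) := Sum.elim 0 d
  have hab' : ∑ i, a' i ≫ b' i = 𝟙 X := by simp [a', b', hab]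
  have hcd' : ∑ i, c' i ≫ d' i = 𝟙 Z := by simp [c', d', hcd]
  -- rows are indexed by the target, as multiplication in `End Y` is reversed composition
  let M : Matrix (Fin n ⊕ Fin m) (Fin n ⊕ Fin m) (End Y) := fun k i => b' i ≫ f ≫ c' k
  obtain ⟨G, hG⟩ := IsSemisimpleRing.exists_mul_mul_eq M
  refine ⟨∑ k, ∑ i, c' k ≫ (show Y ⟶ Y from G i k) ≫ b' i, ?_⟩
  have hM : ∀ l m, b' l ≫ f ≫ (∑ k, ∑ i, c' k ≫ (show Y ⟶ Y from G i k) ≫ b' i) ≫ f ≫ c' m =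
      b' l ≫ f ≫ c' m := by
    intro l m
    have := congrFun (congrFun hG m) l
    simp only [Matrix.mul_apply, End.mul_def, Finset.sum_mul] at this
    refine Eq.trans ?_ this
    simp only [Preadditive.sum_comp, Preadditive.comp_sum, Category.assoc, M]
  calc _ = (∑ i, a' i ≫ b' i) ≫ (f ≫ (∑ k, ∑ i, c' k ≫ (show Y ⟶ Y from G i k) ≫ b' i) ≫ f) ≫
        ∑ i, c' i ≫ d' i := by rw [hab', hcd', Category.id_comp, Category.comp_id]
    _ = ∑ l, ∑ m, a' l ≫ (b' l ≫ f ≫ (∑ k, ∑ i, c' k ≫ (show Y ⟶ Y from G i k) ≫ b' i) ≫ f ≫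
        c' m) ≫ d' m := by
      rw [Preadditive.sum_comp]
      refine Finset.sum_congr rfl fun l _ => ?_
      rw [Preadditive.comp_sum, Preadditive.comp_sum]
      refine Finset.sum_congr rfl fun m _ => ?_
      simp only [Category.assoc]
    _ = (∑ i, a' i ≫ b' i) ≫ f ≫ ∑ i, c' i ≫ d' i := by
      simp only [hM]
      simp only [Preadditive.sum_comp, Preadditive.comp_sum, Category.assoc]
      rw [Finset.sum_comm]
    _ = f := by rw [hab', hcd', Category.id_comp, Category.comp_id]

end Generators

/-! ### Linear structure and finite-dimensional morphism spaces on the envelopes -/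

section LinearInstances

variable {K : Type*} [CommRing K] {C : Type*} [Category C] [Preadditive C] [Linear K C]

instance (M N : Mat_ C) : Module K (M ⟶ N) :=
  inferInstanceAs (Module K (∀ i j, M.X i ⟶ N.X j))

theorem smul_apply_mat (M N : Mat_ C) (r : K) (f : M ⟶ N) (i j) : (r • f) i j = r • f i j := rfl

instance : Linear K (Mat_ C) where
  smul_comp M N L r f g := by
    ext i k
    simp [smul_apply_mat, Finset.smul_sum]
  comp_smul M N L f r g := by
    ext i k
    simp [smul_apply_mat, Finset.smul_sum]

instance {K : Type*} [Field K] [Linear K C] [∀ X Y : C, FiniteDimensional K (X ⟶ Y)]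
    (M N : Mat_ C) : FiniteDimensional K (M ⟶ N) :=
  inferInstanceAs (FiniteDimensional K (∀ i j, M.X i ⟶ N.X j))

namespace KaroubiLinear

open Idempotents

instance (P Q : Karoubi C) : SMul K (P ⟶ Q) :=
  ⟨fun r f => ⟨r • f.f, by simp⟩⟩

theorem smul_f {P Q : Karoubi C} (r : K) (f : P ⟶ Q) : (r • f).f = r • f.f := rfl

instance (P Q : Karoubi C) : Module K (P ⟶ Q) where
  one_smul f := by ext; simp [smul_f]
  mul_smul r s f := by ext; simp [smul_f, mul_smul]
  smul_zero r := by ext; simp [smul_f]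
  smul_add r f g := by ext; simp [smul_f]
  add_smul r s f := by ext; simp [smul_f, add_smul]
  zero_smul f := by ext; simp [smul_f]

instance : Linear K (Karoubi C) where
  smul_comp P Q R r f g := by ext; simp [smul_f]
  comp_smul P Q R f r g := by ext; simp [smul_f]

instance {K : Type*} [Field K] [Linear K C] [∀ X Y : C, FiniteDimensional K (X ⟶ Y)]
    (P Q : Karoubi C) : FiniteDimensional K (P ⟶ Q) :=
  FiniteDimensional.of_injective
    { toFun := fun f : P ⟶ Q => f.f
      map_add' := fun _ _ => rfl
      map_smul' := fun _ _ => rfl } fun _ _ h => Karoubi.hom_ext _ _ h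

end KaroubiLinear

/-- The generator may depend on the pair of objects, since regularity concerns one morphism at a
time. This freedom serves the full categories, where a common generator is not at hand. -/
theorem isSemisimpleAbelian_psAb (K : Type*) [Field K] {C : Type*} [Category C] [Preadditive C]
    [Linear K C] [∀ X Y : C, FiniteDimensional K (X ⟶ Y)]
    (h : ∀ X Z : Mat_ C, ∃ Y, IsSemisimpleRing (End Y) ∧ IsSummandOfPower Y X ∧
      IsSummandOfPower Y Z) : IsSemisimpleAbelian (PsAb C) := by
  have : IsRegularCategory (Mat_ C) := by
    intro X Z f
    obtain ⟨Y, _, hX, hZ⟩ := h X Z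
    exact exists_generalized_inverse hX hZ f
  exact this.karoubi.isSemisimpleAbelian K

end LinearInstances

/-! ### The discriminant of a finite family of objects -/

section Discriminant

open Polynomial Module

variable {R S : Type*} [CommRing R] [CommRing S] {Ob : Type*}

namespace LinearPresentation

/-- The coefficient of a morphism at a basis element. -/
def coord (P : LinearPresentation R Ob) (X Y : P.Cat) (E : P.Basis X.ob Y.ob) : (X ⟶ Y) →ₗ[R] R where
  toFun f := f E
  map_add' _ _ := rfl
  map_smul' _ _ := rfl

theorem sum_apply (P : LinearPresentation R Ob) {X Y : P.Cat} {ι : Type*} (s : Finset ι)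
    (f : ι → (X ⟶ Y)) (E : P.Basis X.ob Y.ob) : (∑ i ∈ s, f i) E = ∑ i ∈ s, f i E :=
  map_sum (P.coord X Y E) f s

/-- The formal direct sum of a finite family of objects. -/
def family (P : LinearPresentation R Ob) {J : Type} [Fintype J] (Y : J → Ob) : Mat_ P.Cat :=
  ⟨J, fun j => ⟨Y j⟩⟩

variable {J : Type} [Fintype J]

/-- The basis of the endomorphism algebra of `family P Y` consisting of the matrix units. -/
def endBasis (P : LinearPresentation R Ob) (Y : J → Ob) :
    Module.Basis (Σ i j, P.Basis (Y i) (Y j)) R (End (P.family Y)) :=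
  open Classical in
  (Pi.basis fun i => Pi.basis fun j => Pi.basisFun R (P.Basis (Y i) (Y j)) :
    Module.Basis _ R (∀ i j, P.Basis (Y i) (Y j) → R))

open Classical in
theorem endBasis_apply (P : LinearPresentation R Ob) (Y : J → Ob) (b) :
    P.endBasis Y b = (Pi.single b.1 (Pi.single b.2.1 (Pi.single b.2.2 1)) :
      ∀ i j, P.Basis (Y i) (Y j) → R) := by
  refine (Pi.basis_apply _ b).trans (congrArg _ ?_)
  refine (Pi.basis_apply _ b.2).trans (congrArg _ ?_)
  exact Pi.basisFun_apply R _ b.2.2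

theorem family_comp_apply (P : LinearPresentation R Ob) (Y : J → Ob)
    (f g : P.family Y ⟶ P.family Y) (i k : J) (E : P.Basis (Y i) (Y k)) :
    (f ≫ g) i k E = ∑ j, ∑ C, ∑ D, f i j C * g j k D * P.coeff C D E :=
  P.sum_apply Finset.univ (fun j : J => f i j ≫ g j k) E

open Classical in
theorem family_id_apply_self (P : LinearPresentation R Ob) (Y : J → Ob) (i : J)
    (E : P.Basis (Y i) (Y i)) :
    (𝟙 (P.family Y) : P.family Y ⟶ P.family Y) i i E = if E = P.one (Y i) then 1 else 0 :=
  (congrFun (Mat_.id_apply_self (P.family Y) i) E).trans (Pi.single_apply _ _ _)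

theorem family_id_apply_of_ne (P : LinearPresentation R Ob) (Y : J → Ob) {i j : J} (h : i ≠ j)
    (E : P.Basis (Y i) (Y j)) : (𝟙 (P.family Y) : P.family Y ⟶ P.family Y) i j E = 0 :=
  congrFun (Mat_.id_apply_of_ne (P.family Y) i j h) E

/-- Coefficientwise base change of endomorphisms. -/
def endMap (P : LinearPresentation R Ob) (Y : J → Ob) (φ : R →+* S) :
    End (P.family Y) →+* End ((P.map φ).family Y) where
  toFun f := fun i j E => φ (f i j E)
  map_one' := by
    classical
    refine funext fun (i : J) => funext fun (j : J) => funext fun (E : P.Basis (Y i) (Y j)) => ?_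
    by_cases h : i = j
    · obtain rfl := h
      refine (congrArg φ (P.family_id_apply_self Y i E)).trans (Eq.trans ?_
        ((P.map φ).family_id_apply_self Y i E).symm)
      change φ (if E = P.one (Y i) then (1 : R) else 0) = if E = P.one (Y i) then (1 : S) else 0
      split_ifs
      · exact map_one φ
      · exact map_zero φ
    · exact (congrArg φ (P.family_id_apply_of_ne Y h E)).trans ((map_zero φ).trans
        ((P.map φ).family_id_apply_of_ne Y h E).symm)
  map_zero' := by
    funext i j E
    exact map_zero φ
  map_add' f g := by
    funext i j E
    exact map_add φ _ _
  map_mul' f g := by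
    funext i k E
    refine (congrArg φ (P.family_comp_apply Y g f i k E)).trans (Eq.trans ?_
      ((P.map φ).family_comp_apply Y _ _ i k E).symm)
    simp only [map_sum, map_mul]
    rfl

/-- Base change does not alter the indexing of the matrix units, so the Gram matrices at all
parameters are specializations of a single one over `ℤ[X]`. -/
theorem traceGram_endBasis_map (P : LinearPresentation R Ob) (Y : J → Ob) (φ : R →+* S) :
    (traceGram R (P.endBasis Y)).map φ = traceGram S ((P.map φ).endBasis Y) := by
  classical
  refine traceGram_map φ (P.endMap Y φ) ?_ _ _ ?_
  · intro r a
    funext i j E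
    exact map_mul φ _ _
  · intro b
    rw [endBasis_apply]
    refine Eq.trans ?_ ((P.map φ).endBasis_apply Y b).symm
    obtain ⟨i, j, C⟩ := b
    refine funext fun (i' : J) => funext fun (j' : J) => funext fun (E : P.Basis (Y i') (Y j')) => ?_
    change φ ((Pi.single i (Pi.single j (Pi.single C 1)) :
      ∀ i j, P.Basis (Y i) (Y j) → R) i' j' E) = (Pi.single i (Pi.single j (Pi.single C 1)) :
      ∀ i j, P.Basis (Y i) (Y j) → S) i' j' E
    by_cases hi : i' = i
    · subst hi
      by_cases hj : j' = j
      · subst hj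
        simp only [Pi.single_eq_same, Pi.single_apply]
        split_ifs
        · exact map_one φ
        · exact map_zero φ
      · simp [Pi.single_eq_of_ne hj]
    · simp [Pi.single_eq_of_ne hi]

/-- Matrices representing the morphisms between the members of a family at some integral parameter,
such that the space of representing matrices is closed under transposition. -/
def HasTransposeRep (P : LinearPresentation ℤ[X] Ob) (Y : J → Ob) : Prop :=
  ∃ (τ : ℤ) (T : J → Type) (_ : ∀ j, Fintype (T j))
    (ρ : ∀ i j, P.Basis (Y i) (Y j) → Matrix (T i) (T j) ℝ),
    (∀ i j k C D, ρ i j C * ρ j k D =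
      ∑ E, (((P.coeff C D E).eval τ : ℤ) : ℝ) • ρ i k E) ∧
    (∀ i j, LinearIndependent ℝ (ρ i j)) ∧
    ∀ i j C, ∃ (s : ℝ) (D : P.Basis (Y j) (Y i)), (ρ i j C).transpose = s • ρ j i D

theorem specialize_coeff_intCast (P : LinearPresentation ℤ[X] Ob) (τ : ℤ) {X Y Z : Ob}
    (C : P.Basis X Y) (D : P.Basis Y Z) (E : P.Basis X Z) :
    (P.specialize (τ : ℝ)).coeff C D E = (((P.coeff C D E).eval τ : ℤ) : ℝ) := by
  change eval₂ (Int.castRingHom ℝ) (τ : ℝ) (P.coeff C D E) = _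
  exact eval₂_at_apply (Int.castRingHom ℝ) τ

theorem HasTransposeRep.exists_trace_nondegenerate {P : LinearPresentation ℤ[X] Ob} {Y : J → Ob}
    (h : P.HasTransposeRep Y) : ∃ τ : ℤ, ∀ x : End ((P.specialize (τ : ℝ)).family Y),
      (∀ y, regularTrace ℝ _ (x * y) = 0) → x = 0 := by
  classical
  obtain ⟨τ, T, _, ρ, hmul, hli, htr⟩ := h
  refine ⟨τ, ?_⟩
  set Q := P.specialize (τ : ℝ)
  let m : ∀ i j, ((⟨Y i⟩ : Q.Cat) ⟶ ⟨Y j⟩) →ₗ[ℝ] Matrix (T i) (T j) ℝ := fun i j =>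
    (Fintype.linearCombination ℝ (ρ i j) : (P.Basis (Y i) (Y j) → ℝ) →ₗ[ℝ] Matrix (T i) (T j) ℝ)
  have hm : ∀ i j f, m i j f = ∑ C : P.Basis (Y i) (Y j), f C • ρ i j C := fun i j f => rfl
  have hminj : ∀ i j, Function.Injective (m i j) := fun i j =>
    (linearIndependent_iff_injective_fintypeLinearCombination (R := ℝ) (v := ρ i j)).1 (hli i j)
  have hcoeff : ∀ i j k (f : P.Basis (Y i) (Y j) → ℝ) (g : P.Basis (Y j) (Y k) → ℝ),
      ∑ E, (∑ C, ∑ D, f C * g D * (((P.coeff C D E).eval τ : ℤ) : ℝ)) • ρ i k E =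
        (∑ C, f C • ρ i j C) * ∑ D, g D • ρ j k D := by
    intro i j k f g
    simp only [Matrix.sum_mul, Matrix.mul_sum, Matrix.smul_mul, Matrix.mul_smul, hmul,
      Finset.smul_sum, Finset.sum_smul, smul_smul]
    conv_rhs => rw [Finset.sum_comm]
    rw [Finset.sum_comm]
    refine Finset.sum_congr rfl fun C _ => ?_
    rw [Finset.sum_comm]
    refine Finset.sum_congr rfl fun D _ => Finset.sum_congr rfl fun E _ => ?_
    congr 1
    ring
  have hmmul : ∀ i j k f g, m i k (f ≫ g) = m i j f * m j k g := by
    intro i j k f g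
    refine Eq.trans ?_ (hcoeff i j k f g)
    simp only [← specialize_coeff_intCast]
    rfl
  have hmtr : ∀ i j f, ∃ g, m j i g = (m i j f).transpose := by
    intro i j f
    choose s D hD using htr i j
    refine ⟨∑ C : P.Basis (Y i) (Y j), (f C * s C) •
      (show (⟨Y j⟩ : Q.Cat) ⟶ ⟨Y i⟩ from Pi.single (D C) (1 : ℝ)), ?_⟩
    rw [map_sum, hm i j, Matrix.transpose_sum]
    refine Finset.sum_congr rfl fun C _ => ?_
    rw [map_smul, Matrix.transpose_smul, hD, smul_smul]
    congr 1
    exact (Fintype.linearCombination_apply_single ..).trans (one_smul _ _)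
  -- Multiplication in `End` is reversed composition, whereas `m` respects the order of composition;
  -- the whole block matrix is therefore transposed.
  let B : End (Q.family Y) →ₗ[ℝ] Matrix (Σ j, T j) (Σ j, T j) ℝ :=
    { toFun := fun x => Matrix.of fun p q => m q.1 p.1 (x q.1 p.1) q.2 p.2
      map_add' := fun x y => by
        ext p q
        exact congrFun (congrFun (map_add (m q.1 p.1) (x q.1 p.1) (y q.1 p.1)) q.2) p.2
      map_smul' := fun r x => by
        ext p q
        exact congrFun (congrFun (map_smul (m q.1 p.1) r (x q.1 p.1)) q.2) p.2 }
  have hB : ∀ x p q, B x p q = m q.1 p.1 (x q.1 p.1) q.2 p.2 := fun _ _ _ => rfl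
  have : FiniteDimensional ℝ (End (Q.family Y)) := (Q.endBasis Y).finiteDimensional_of_finite
  refine trace_nondegenerate_of_transpose B ?_ ?_ ?_
  · intro x y hxy
    funext i j
    apply hminj i j
    ext s t
    exact congrFun (congrFun hxy ⟨j, t⟩) ⟨i, s⟩
  · intro x y
    ext ⟨k, s⟩ ⟨i, t⟩
    rw [hB, Matrix.mul_apply, Fintype.sum_sigma]
    have : (x * y) i k = ∑ j : J, y i j ≫ x j k := rfl
    simp only [hB]
    rw [this]
    refine (congrFun (congrFun (map_sum (m i k) (fun j : J => y i j ≫ x j k) Finset.univ) t)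
      s).trans ?_
    rw [Matrix.sum_apply]
    refine Finset.sum_congr rfl fun j _ => ?_
    refine (congrFun (congrFun (hmmul i j k (y i j) (x j k)) t) s).trans ?_
    rw [Matrix.mul_apply]
    exact Finset.sum_congr rfl fun u _ => mul_comm _ _
  · intro x
    choose g hg using fun i j => hmtr i j (x i j)
    refine ⟨fun i j => g j i, ?_⟩
    ext p q
    exact congrFun (congrFun (hg p.1 q.1) q.2) p.2

/-- The witness is the Gram determinant over `ℤ[X]`: its value at the real representation shows that
it is not zero, and its value at `t` decides nondegeneracy at `t`. It is chosen before the field. -/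
theorem HasTransposeRep.exists_discriminant {P : LinearPresentation ℤ[X] Ob} {Y : J → Ob}
    (h : P.HasTransposeRep Y) : ∃ d : ℤ[X], d ≠ 0 ∧ ∀ (F : Type*) [Field F] (t : F),
      d.eval₂ (Int.castRingHom F) t ≠ 0 → IsSemisimpleRing (End ((P.specialize t).family Y)) := by
  classical
  have key : ∀ (F : Type _) [Field F] (t : F),
      (traceGram ℤ[X] (P.endBasis Y)).det.eval₂ (Int.castRingHom F) t =
        (traceGram F ((P.specialize t).endBasis Y)).det := by
    intro F _ t
    have := (eval₂RingHom (Int.castRingHom F) t).map_det (traceGram ℤ[X] (P.endBasis Y))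
    rw [RingHom.mapMatrix_apply, traceGram_endBasis_map] at this
    exact this
  refine ⟨(traceGram ℤ[X] (P.endBasis Y)).det, ?_, ?_⟩
  · intro h0
    obtain ⟨τ, hτ⟩ := h.exists_trace_nondegenerate
    refine (traceGram_det_ne_zero_iff ((P.specialize (τ : ℝ)).endBasis Y)).2 hτ ?_
    have := (eval₂RingHom (Int.castRingHom ℝ) (τ : ℝ)).map_det (traceGram ℤ[X] (P.endBasis Y))
    rw [RingHom.mapMatrix_apply, traceGram_endBasis_map, h0, map_zero] at this
    exact this.symm
  · intro F _ t ht
    rw [key, traceGram_det_ne_zero_iff] at ht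
    have : FiniteDimensional F (End ((P.specialize t).family Y)) :=
      ((P.specialize t).endBasis Y).finiteDimensional_of_finite
    exact isSemisimpleRing_of_trace ht

instance {F : Type*} [Field F] (P : LinearPresentation F Ob) (X Y : P.Cat) :
    FiniteDimensional F (X ⟶ Y) :=
  inferInstanceAs (FiniteDimensional F (P.Basis X.ob Y.ob → F))

end LinearPresentation

end Discriminant

/-! ### From discriminants to the pseudo-abelian envelopes -/

section Envelope

open Polynomial Limits

theorem isSummandOfPower_self {D : Type*} [Category D] [Preadditive D] {X Y : D} (a : X ⟶ Y)
    (b : Y ⟶ X) (h : a ≫ b = 𝟙 X) : IsSummandOfPower Y X :=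
  ⟨1, fun _ => a, fun _ => b, by simpa using h⟩

/-- An object of `Mat_ C` is the biproduct of its entries, and each entry is a retract of an entry
of `Y`. One copy of `Y` per entry of `X` is enough. -/
theorem isSummandOfPower_mat {C : Type*} [Category C] [Preadditive C] {Y X : Mat_ C}
    (h : ∀ i, ∃ (j : Y.ι) (a : X.X i ⟶ Y.X j) (b : Y.X j ⟶ X.X i), a ≫ b = 𝟙 _) :
    IsSummandOfPower Y X := by
  classical
  choose j a b hab using h
  let eX := X.isoBiproductEmbedding
  let eY := Y.isoBiproductEmbedding
  let E := Mat_.embedding C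
  refine isSummandOfPower_of_sum
    (fun i => eX.hom ≫ biproduct.π _ i ≫ E.map (a i) ≫ biproduct.ι (fun k => E.obj (Y.X k)) (j i) ≫
      eY.inv)
    (fun i => eY.hom ≫ biproduct.π (fun k => E.obj (Y.X k)) (j i) ≫ E.map (b i) ≫
      biproduct.ι (fun k => E.obj (X.X k)) i ≫ eX.inv) ?_
  have h1 : ∀ i, E.map (a i) ≫ E.map (b i) = 𝟙 _ := fun i => by rw [← E.map_comp, hab, E.map_id]
  calc _ = eX.hom ≫ (∑ i, biproduct.π (fun k => E.obj (X.X k)) i ≫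
        biproduct.ι (fun k => E.obj (X.X k)) i) ≫
        eX.inv := by
        simp only [Preadditive.sum_comp, Preadditive.comp_sum, Category.assoc]
        refine Finset.sum_congr rfl fun i _ => ?_
        simp [reassoc_of% h1]
        rfl
    _ = _ := by rw [biproduct.total, Category.id_comp, Iso.hom_inv_id]

namespace LinearPresentation

variable {Ob : Type*}

/-- Two objects `M`, `N` are summands of `M ⊞ N`, whose discriminant is a nonzero integral
polynomial and so does not vanish at a transcendental `t`. -/
theorem isSemisimpleAbelian_of_transcendental (P : LinearPresentation ℤ[X] Ob)
    (hP : ∀ (J : Type) [Fintype J] (Y : J → Ob), P.HasTransposeRep Y) (F : Type*) [Field F]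
    [CharZero F] (t : F) (ht : Transcendental ℚ t) :
    IsSemisimpleAbelian (PsAb (P.specialize t).Cat) := by
  classical
  have : HasBinaryBiproducts (Mat_ (P.specialize t).Cat) := hasBinaryBiproducts_of_finite_biproducts _
  refine isSemisimpleAbelian_psAb F fun M N => ⟨M ⊞ N, ?_,
    isSummandOfPower_self biprod.inl biprod.fst (by simp),
    isSummandOfPower_self biprod.inr biprod.snd (by simp)⟩
  obtain ⟨d, hd, h⟩ := (hP (M ⊞ N).ι fun i => ((M ⊞ N).X i).ob).exists_discriminant
  refine h F t fun h0 => hd ?_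
  have h1 := (transcendental_iff.1 (ht.restrictScalars (Int.cast_injective (α := ℚ))) d)
  exact h1 h0

/-- The family `Y` does not depend on `t` and contains every object satisfying `Q` up to retracts.
Its discriminant therefore controls the truncated category for all `t` at once, and every
exceptional `t` is a root of it. -/
theorem finite_not_isSemisimpleAbelian (P : LinearPresentation ℤ[X] Ob)
    (hP : ∀ (J : Type) [Fintype J] (Y : J → Ob), P.HasTransposeRep Y) (Q : Ob → Prop) (F : Type*)
    [Field F] [CharZero F] {J : Type} [Fintype J] (Y : J → Ob) (hY : ∀ j, Q (Y j))
    (hQ : ∀ (t : F) (X : (P.specialize t).Cat), Q X.ob →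
      ∃ (j : J) (a : X ⟶ ⟨Y j⟩) (b : ⟨Y j⟩ ⟶ X), a ≫ b = 𝟙 X) :
    {t : F | ¬ IsSemisimpleAbelian (PsAb (ObjectProperty.FullSubcategory
      fun X : (P.specialize t).Cat => Q X.ob))}.Finite ∧
    ∀ t : F, ¬ IsSemisimpleAbelian (PsAb (ObjectProperty.FullSubcategory
      fun X : (P.specialize t).Cat => Q X.ob)) → IsAlgebraic ℚ t := by
  obtain ⟨d, hd, h⟩ := (hP J Y).exists_discriminant
  have key : ∀ t : F, ¬ IsSemisimpleAbelian (PsAb (ObjectProperty.FullSubcategory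
      fun X : (P.specialize t).Cat => Q X.ob)) → d.eval₂ (Int.castRingHom F) t = 0 := by
    intro t ht
    by_contra h0
    apply ht
    have hs := h F t h0
    let C := ObjectProperty.FullSubcategory fun X : (P.specialize t).Cat => Q X.ob
    have : ∀ X Y : C, FiniteDimensional F (X ⟶ Y) := fun X Y =>
      FiniteDimensional.of_injective (V₂ := X.obj ⟶ Y.obj)
        { toFun := fun f : X ⟶ Y => f.hom
          map_add' := fun _ _ => rfl
          map_smul' := fun _ _ => rfl } fun _ _ hfg => ObjectProperty.hom_ext _ hfg
    let Y' : Mat_ C := ⟨J, fun j => ⟨⟨Y j⟩, hY j⟩⟩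
    -- The subcategory is full, so the formal direct sum has the same endomorphism ring inside it.
    let e : End ((P.specialize t).family Y) ≃+* End Y' :=
      { toFun := fun f i j => ObjectProperty.homMk (f i j)
        invFun := fun f i j => (f i j).hom
        left_inv := fun f => rfl
        right_inv := fun f => rfl
        map_add' := fun f g => rfl
        map_mul' := fun f g => by
          funext i k
          apply ObjectProperty.hom_ext
          let φ : (Y'.X i ⟶ Y'.X k) →+ ((Y'.X i).obj ⟶ (Y'.X k).obj) :=
            { toFun := fun h => h.hom, map_zero' := rfl, map_add' := fun _ _ => rfl }
          exact (map_sum φ (fun j : J => (ObjectProperty.homMk (g i j) : Y'.X i ⟶ Y'.X j) ≫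
            (ObjectProperty.homMk (f j k) : Y'.X j ⟶ Y'.X k)) Finset.univ).symm  }
    have := e.isSemisimpleRing
    have hgen : ∀ M : Mat_ C, IsSummandOfPower Y' M := by
      intro M
      refine isSummandOfPower_mat fun i => ?_
      obtain ⟨j, a, b, hab⟩ := hQ t (M.X i).obj (M.X i).property
      exact ⟨j, ObjectProperty.homMk a, ObjectProperty.homMk b, ObjectProperty.hom_ext _ hab⟩
    exact isSemisimpleAbelian_psAb F fun M N => ⟨Y', this, hgen M, hgen N⟩
  classical
  have hinj : Function.Injective (Int.castRingHom F) := Int.cast_injective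
  constructor
  · refine ((d.map (Int.castRingHom F)).roots.toFinset.finite_toSet).subset fun t ht => ?_
    simp only [Finset.mem_coe, Multiset.mem_toFinset]
    rw [Polynomial.mem_roots ((Polynomial.map_ne_zero_iff hinj).2 hd), Polynomial.IsRoot,
      Polynomial.eval_map]
    exact key t ht
  · intro t ht
    have : IsAlgebraic ℤ t := ⟨d, hd, key t ht⟩
    exact this.extendScalars (Int.cast_injective (α := ℚ))

end LinearPresentation

end Envelope

/-! ### Transpose-closed real representations at integral parameters -/

section Representations

open Polynomial Classical

/-- The partner of a point for `s` is related to it by `t`, hence is its partner for `t` too. -/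
theorem IsMatching.eq_of_le {α : Type*} {s t : Setoid α} (hs : IsMatching s) (ht : IsMatching t)
    (h : s ≤ t) : s = t := by
  refine le_antisymm h fun x y hxy => ?_
  by_cases hyx : y = x
  · subst hyx
    exact s.refl' _
  · obtain ⟨z, ⟨hz1, hz2⟩, -⟩ := hs x
    rw [(ht x).unique ⟨hyx, hxy⟩ ⟨hz1, h hz2⟩]
    exact hz2

theorem IsMatching.swap {U V : Type} {C : Setoid (U ⊕ V)} (hC : IsMatching C) :
    IsMatching (C.comap Sum.swap) := by
  intro x
  obtain ⟨y, ⟨hy1, hy2⟩, hy⟩ := hC x.swap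
  refine ⟨y.swap, ⟨fun h => hy1 (by rw [← h, Sum.swap_swap]), ?_⟩, ?_⟩
  · change C x.swap y.swap.swap
    rwa [Sum.swap_swap]
  · rintro z ⟨hz1, hz2⟩
    rw [← hy z.swap ⟨fun h => hz1 (by rw [← Sum.swap_swap z, h, Sum.swap_swap]), hz2⟩,
      Sum.swap_swap]

/-- Exchanging source and target replaces the two-colouring by its complement, which does not affect
bicolouredness. -/
theorem IsWalled.swap {x y : ℕ × ℕ} {C : Setoid (Factors x ⊕ Factors y)} (hC : IsWalled C) :
    IsWalled (x := y) (y := x) (C.comap Sum.swap) := by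
  refine ⟨hC.1.swap, fun a b hab hne h => ?_⟩
  refine hC.2 a.swap b.swap hab (fun h' => hne ?_) ?_
  · rw [← Sum.swap_swap a, h', Sum.swap_swap]
  · rcases a with a | a <;> rcases b with b | b
    · exact congrArg (fun c => !c) h
    · exact (congrArg (fun c => !c) h).trans (Bool.not_not _)
    · exact (Bool.not_not _).symm.trans (congrArg (fun c => !c) h)
    · exact Bool.not_inj h

theorem comap_swap_ker {U V γ : Type} (f : U → γ) (g : V → γ) :
    (Setoid.ker (Sum.elim f g)).comap Sum.swap = Setoid.ker (Sum.elim g f) := by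
  ext x y
  rcases x with x | x <;> rcases y with y | y <;> rfl

theorem comap_swap_comap_swap {U V : Type} (C : Setoid (U ⊕ V)) :
    (C.comap Sum.swap).comap Sum.swap = C := by
  ext x y
  rcases x with x | x <;> rcases y with y | y <;> rfl

theorem comap_swap_injective {U V : Type} :
    Function.Injective fun C : Setoid (U ⊕ V) => C.comap Sum.swap := by
  intro C D h
  rw [← comap_swap_comap_swap C, ← comap_swap_comap_swap D]
  exact congrArg (Setoid.comap Sum.swap) h

theorem comap_swap_le_ker_iff {U V γ : Type} (C : Setoid (U ⊕ V)) (f : U → γ) (g : V → γ) :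
    C.comap Sum.swap ≤ Setoid.ker (Sum.elim g f) ↔ C ≤ Setoid.ker (Sum.elim f g) := by
  constructor
  · intro h
    rw [← comap_swap_comap_swap C, ← comap_swap_ker]
    exact fun x y hxy => h hxy
  · intro h
    rw [← comap_swap_ker]
    exact fun x y hxy => h hxy

/-- This supplies a number of colours sufficient to separate the classes of every diagram between
two members of the family, as `exists_ker` demands. -/
theorem exists_card_bound {J : Type} [Fintype J] (T : J → Type) :
    ∃ n : ℕ, ∀ i j, Nat.card (T i ⊕ T j) ≤ n :=
  ⟨∑ i, ∑ j, Nat.card (T i ⊕ T j), fun i j =>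
    (Finset.single_le_sum (f := fun j => Nat.card (T i ⊕ T j)) (fun _ _ => Nat.zero_le _)
      (Finset.mem_univ j)).trans
    (Finset.single_le_sum (f := fun i => ∑ j, Nat.card (T i ⊕ T j)) (fun _ _ => Nat.zero_le _)
      (Finset.mem_univ i))⟩

/-- At a parameter for which loops take the value `n`, the matchings act on the tensor powers of an
`n`-dimensional space with a fixed orthonormal basis. -/
theorem diagramPresentation_hasTransposeRep {Ob : Type} (pts : Ob → Type) [∀ X, Finite (pts X)]
    (good : ∀ X Y, Setoid (pts X ⊕ pts Y) → Prop)
    (good_diag : ∀ X, good X X (diag (pts X)))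
    (good_stack : ∀ {X Y Z} {C : Setoid (pts X ⊕ pts Y)} {D : Setoid (pts Y ⊕ pts Z)},
      good X Y C → good Y Z D → good X Z (stack C D))
    (ε : ∀ {X Y}, Setoid (pts X ⊕ pts Y) → ℤ)
    (ε_sq : ∀ {X Y} (C : Setoid (pts X ⊕ pts Y)), ε C * ε C = 1)
    (ε_diag : ∀ X, ε (diag (pts X)) = 1) (δ : ℤ[X])
    (hgood : ∀ {X Y} {C : Setoid (pts X ⊕ pts Y)}, good X Y C → IsMatching C)
    (hswap : ∀ {X Y} {C : Setoid (pts X ⊕ pts Y)}, good X Y C → good Y X (C.comap Sum.swap))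
    (hδ : ∀ n : ℕ, ∃ τ : ℤ, δ.eval τ = n) {J : Type} [Fintype J] (Y : J → Ob) :
    (diagramPresentation pts good good_diag good_stack ε ε_sq ε_diag δ).HasTransposeRep Y := by
  have : ∀ X, Fintype (pts X) := fun X => Fintype.ofFinite _
  obtain ⟨n, hn⟩ := exists_card_bound fun j => pts (Y j)
  obtain ⟨τ, hτ⟩ := hδ n
  have hε : ∀ {X Y} (C : Setoid (pts X ⊕ pts Y)), (ε C : ℝ) * ε C = 1 := fun C => by
    exact_mod_cast ε_sq C
  -- Up to the sign, the entry tests whether the colouring `f`, `h` of source and target is constant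
  -- on matched pairs; this is the matrix of the diagram for the standard symmetric form on `ℝⁿ`.
  -- Rescaling by `ε` absorbs the signs of the composition rule.
  let ρ : ∀ i j, {C : Setoid (pts (Y i) ⊕ pts (Y j)) // good _ _ C} →
      Matrix (pts (Y i) → Fin n) (pts (Y j) → Fin n) ℝ := fun i j C =>
    Matrix.of fun f g => if C.1 ≤ Setoid.ker (Sum.elim f g) then (ε C.1 : ℝ) else 0
  have hρ : ∀ i j C f g, ρ i j C f g =
    if C.1 ≤ Setoid.ker (Sum.elim f g) then (ε C.1 : ℝ) else 0 := fun _ _ _ _ _ => rfl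
  -- The matrix product sums over colourings of the middle points; by `sum_glue` there are `n ^
  -- loops` compatible ones when the outer colouring respects the stacked diagram, and none
  -- otherwise.
  have hmul : ∀ i j k (C : {C : Setoid (pts (Y i) ⊕ pts (Y j)) // good _ _ C})
      (D : {D : Setoid (pts (Y j) ⊕ pts (Y k)) // good _ _ D}),
      ρ i j C * ρ j k D = (ε C.1 * ε D.1 * ε (stack C.1 D.1) * (n : ℝ) ^ loops C.1 D.1) •
        ρ i k ⟨stack C.1 D.1, good_stack C.2 D.2⟩ := by
    intro i j k C D
    ext f h
    have h1 := sum_glue C.1 D.1 n f h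
    have h2 : ∀ g, ρ i j C f g * ρ j k D g h = (ε C.1 * ε D.1 : ℝ) *
        ((if C.1 ≤ Setoid.ker (Sum.elim f g) ∧ D.1 ≤ Setoid.ker (Sum.elim g h) then 1 else 0 : ℕ)
          : ℝ) := by
      intro g
      rw [hρ, hρ]
      by_cases hC : C.1 ≤ Setoid.ker (Sum.elim f g) <;>
        by_cases hD : D.1 ≤ Setoid.ker (Sum.elim g h) <;> simp [hC, hD]
    rw [Matrix.mul_apply, Finset.sum_congr rfl fun g _ => h2 g, ← Finset.mul_sum,
      ← Nat.cast_sum, h1, Matrix.smul_apply, hρ]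
    split_ifs
    · rw [smul_eq_mul]
      push_cast
      linear_combination -(ε C.1 * ε D.1 * (n : ℝ) ^ loops C.1 D.1) * hε (stack C.1 D.1)
    · simp
  have hli : ∀ i j, LinearIndependent ℝ (ρ i j) := by
    intro i j
    let _ : Fintype {C : Setoid (pts (Y i) ⊕ pts (Y j)) // good _ _ C} := Fintype.ofFinite _
    rw [Fintype.linearIndependent_iff]
    intro a ha E
    -- A colouring with kernel exactly `E` respects no other matching, because comparable matchings
    -- are equal. The corresponding matrix entry isolates the coefficient of `E`.
    obtain ⟨f, h, hE⟩ := exists_ker E.1 n (hn i j)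
    have h1 := congrFun (congrFun ha f) h
    rw [Matrix.sum_apply, Finset.sum_eq_single E] at h1
    · rw [Matrix.smul_apply, hρ, ← hE, if_pos le_rfl, Matrix.zero_apply, smul_eq_mul] at h1
      linear_combination ε E.1 * h1 - a E * hε E.1
    · intro C _ hC
      rw [Matrix.smul_apply, hρ, ← hE, if_neg, smul_zero]
      exact fun h => hC (Subtype.ext ((hgood C.2).eq_of_le (hgood E.2) h))
    · exact fun h => absurd (Finset.mem_univ _) h
  have htr : ∀ i j C, (ρ i j C).transpose = (ε C.1 * ε (C.1.comap Sum.swap) : ℝ) •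
      ρ j i ⟨C.1.comap Sum.swap, hswap C.2⟩ := by
    intro i j C
    ext g f
    rw [Matrix.transpose_apply, Matrix.smul_apply, hρ, hρ]
    simp only [comap_swap_le_ker_iff]
    split_ifs
    · rw [smul_eq_mul]
      linear_combination -(ε C.1 : ℝ) * hε (C.1.comap Sum.swap)
    · simp
  refine ⟨τ, fun j => pts (Y j) → Fin n, fun j => inferInstance, ρ, fun i j k C D => ?_, hli,
    fun i j C => ⟨_, _, htr i j C⟩⟩
  refine (hmul i j k C D).trans (Eq.trans ?_ (Finset.sum_eq_single (s := Finset.univ)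
    ⟨stack C.1 D.1, good_stack C.2 D.2⟩ (fun E _ hE => ?_)
    fun h => absurd (Finset.mem_univ _) h).symm)
  · refine congrArg (· • ρ i k ⟨stack C.1 D.1, good_stack C.2 D.2⟩) ?_
    refine Eq.trans ?_ (congrArg (fun p : ℤ[X] => ((p.eval τ : ℤ) : ℝ)) (if_pos rfl :
      _ = Polynomial.C (ε C.1 * ε D.1 * ε (stack C.1 D.1)) * δ ^ loops C.1 D.1)).symm
    rw [eval_mul, eval_C, eval_pow, hτ]
    push_cast
    rfl
  · refine (congrArg (fun p : ℤ[X] => ((p.eval τ : ℤ) : ℝ) • ρ i k E)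
      (if_neg fun h => hE (Subtype.ext h.symm))).trans ?_
    simp

theorem orthogonalPresentation_hasTransposeRep {J : Type} [Fintype J] (Y : J → ℕ) :
    orthogonalPresentation.HasTransposeRep Y :=
  diagramPresentation_hasTransposeRep _ _ _ stack_isMatching _ (fun _ => one_mul 1) _ _
    (fun h => h) (fun h => h.swap) (fun n => ⟨n, eval_X⟩) Y

/-- The orthonormal basis identifies `V` with `V*`, so walled diagrams act as the Brauer diagrams
that they are; only stability under stacking and reversal depends on the colours. -/
theorem generalLinearPresentation_hasTransposeRep {J : Type} [Fintype J] (Y : J → ℕ × ℕ) :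
    generalLinearPresentation.HasTransposeRep Y :=
  diagramPresentation_hasTransposeRep _ _ _
    (fun hC hD => ⟨stack_isMatching hC.1 hD.1, (stack_props hC.1 hD.1).2 _ _ _ hC.2 hD.2⟩) _
    (fun _ => one_mul 1) _ _ (fun h => h.1) (fun h => h.swap) (fun n => ⟨n, eval_X⟩) Y

/-- A loop has the value `-T`, so at `T = -n` the symplectic rule is, up to rescaling diagrams by
signs, the orthogonal rule with loop value `n`. This avoids symplectic forms, and the transposition
argument applies unchanged. -/
theorem symplecticPresentation_hasTransposeRep {J : Type} [Fintype J] (Y : J → ℕ) :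
    symplecticPresentation.HasTransposeRep Y :=
  diagramPresentation_hasTransposeRep _ _ _ stack_isMatching _
    (fun C => by rw [← mul_pow]; simp) _ _ (fun h => h) (fun h => h.swap)
    (fun n => ⟨-n, by simp⟩) Y

/-- The recollements of two types. -/
abbrev Recollements (U V : Type) : Type := {C : Setoid (U ⊕ V) // IsRecollement C}

theorem IsRecollement.swap {U V : Type} {C : Setoid (U ⊕ V)} (h : IsRecollement C) :
    IsRecollement (C.comap Sum.swap) :=
  ⟨h.2, h.1⟩

/-- At `T = n`, the recollements act on the spaces spanned by the maps to a set with `n` elements. -/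
theorem symmetricPresentation_hasTransposeRep {J : Type} [Fintype J] (Y : J → FinSet) :
    symmetricPresentation.HasTransposeRep Y := by
  have : ∀ X : FinSet, Fintype X.carrier := fun X => Fintype.ofFinite _
  obtain ⟨n, hn⟩ := exists_card_bound fun j => (Y j).carrier
  -- Requiring equality of the kernel with `C` forces both colourings to be injective. The identity
  -- thus acts as the projection to the injective colourings, so the representation need not be
  -- unital.
  let ρ : ∀ i j, Recollements (Y i).carrier (Y j).carrier →
      Matrix ((Y i).carrier → Fin n) ((Y j).carrier → Fin n) ℝ := fun i j C =>
    Matrix.of fun f g => if Setoid.ker (Sum.elim f g) = C.1 then (1 : ℝ) else 0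
  have hρ : ∀ i j C f g, ρ i j C f g =
    if Setoid.ker (Sum.elim f g) = C.1 then (1 : ℝ) else 0 := fun _ _ _ _ _ => rfl
  have hmul : ∀ i j k (C : Recollements (Y i).carrier (Y j).carrier)
      (D : Recollements (Y j).carrier (Y k).carrier) f h, (ρ i j C * ρ j k D) f h =
      (((recollementPoly C.1 D.1 (Setoid.ker (Sum.elim f h))).eval (n : ℤ) : ℤ) : ℝ) := by
    intro i j k C D f h
    rw [← sum_recollement, Matrix.mul_apply]
    push_cast
    refine Finset.sum_congr rfl fun g _ => ?_
    rw [hρ, hρ]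
    by_cases hC : Setoid.ker (Sum.elim f g) = C.1 <;>
      by_cases hD : Setoid.ker (Sum.elim g h) = D.1 <;> simp [hC, hD]
  have hsum : ∀ i j k (C : Recollements (Y i).carrier (Y j).carrier)
      (D : Recollements (Y j).carrier (Y k).carrier)
      [Fintype (Recollements (Y i).carrier (Y k).carrier)],
      ρ i j C * ρ j k D = ∑ E : Recollements (Y i).carrier (Y k).carrier,
        (((recollementPoly C.1 D.1 E.1).eval (n : ℤ) : ℤ) : ℝ) • ρ i k E := by
    intro i j k C D _
    ext f h
    rw [Matrix.sum_apply]
    by_cases hE : IsRecollement (Setoid.ker (Sum.elim f h))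
    · rw [hmul]
      refine Eq.trans ?_
        (Finset.sum_eq_single (⟨_, hE⟩ : Recollements (Y i).carrier (Y k).carrier) ?_ ?_).symm
      · rw [Matrix.smul_apply, hρ, if_pos rfl, smul_eq_mul, mul_one]
      · intro E _ hne
        rw [Matrix.smul_apply, hρ, if_neg, smul_zero]
        exact fun h => hne (Subtype.ext h.symm)
      · exact fun h => absurd (Finset.mem_univ _) h
    -- If `f` or `h` is not injective, no recollement occurs as the outer kernel and both sides
    -- vanish.
    · rw [Matrix.mul_apply]
      refine Eq.trans (Finset.sum_eq_zero fun g _ => ?_) (Finset.sum_eq_zero fun E _ => ?_).symm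
      · rw [hρ, hρ]
        split_ifs with h2 h3
        · have hf := (h2 ▸ C.2 : IsRecollement (Setoid.ker (Sum.elim f g))).injective.1
          have hh := (h3 ▸ D.2 : IsRecollement (Setoid.ker (Sum.elim g h))).injective.2
          exact absurd (isRecollement_ker hf hh) hE
        all_goals simp
      · rw [Matrix.smul_apply, hρ, if_neg, smul_zero]
        exact fun h => hE (h ▸ E.2)
  have hli : ∀ i j, LinearIndependent ℝ (ρ i j) := by
    intro i j
    let _ : Fintype (Recollements (Y i).carrier (Y j).carrier) := Fintype.ofFinite _
    rw [Fintype.linearIndependent_iff]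
    intro a ha E
    obtain ⟨f, h, hE⟩ := exists_ker E.1 n (hn i j)
    have h1 := congrFun (congrFun ha f) h
    rw [Matrix.sum_apply, Finset.sum_eq_single E] at h1
    · rwa [Matrix.smul_apply, hρ, ← hE, if_pos rfl, Matrix.zero_apply, smul_eq_mul, mul_one] at h1
    · intro C _ hC
      rw [Matrix.smul_apply, hρ, ← hE, if_neg, smul_zero]
      exact fun h => hC (Subtype.ext h.symm)
    · exact fun h => absurd (Finset.mem_univ _) h
  have htr : ∀ i j (C : Recollements (Y i).carrier (Y j).carrier), (ρ i j C).transpose =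
      (1 : ℝ) • ρ j i ⟨C.1.comap Sum.swap, C.2.swap⟩ := by
    intro i j C
    ext g f
    rw [Matrix.transpose_apply, one_smul, hρ, hρ, ← comap_swap_ker f g]
    exact if_congr comap_swap_injective.eq_iff.symm rfl rfl
  exact ⟨n, fun j => (Y j).carrier → Fin n, fun j => inferInstance, ρ,
    fun i j k C D => @hsum i j k C D (Fintype.ofFinite _), hli, fun i j C => ⟨_, _, htr i j C⟩⟩

/-! ### Bijections of finite sets as morphisms -/

theorem ker_eq_graph_iff {U V γ : Type} (e : U ≃ V) {f : U → γ} (hf : Function.Injective f)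
    {g : V → γ} :
    Setoid.ker (Sum.elim g f) = Setoid.ker (Sum.elim id e) ↔ g = f ∘ e.symm := by
  constructor
  · intro h
    funext v
    have h1 : Setoid.ker (Sum.elim id e) (Sum.inl v) (Sum.inr (e.symm v)) :=
      (e.apply_symm_apply v).symm
    rw [← h] at h1
    exact h1
  · rintro rfl
    have : Sum.elim (f ∘ e.symm) f = (f ∘ e.symm) ∘ Sum.elim id e := by
      funext x
      rcases x with x | x <;> simp
    rw [this]
    ext x y
    exact (hf.comp e.symm.injective).eq_iff

/-- The composite of the graphs of inverse bijections is the identity. -/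
theorem recollementPoly_graph {U V : Type} [Finite U] [Finite V] (e : U ≃ V) (E : Setoid (U ⊕ U))
    (hE : IsRecollement E) :
    recollementPoly (Setoid.ker (Sum.elim e id)) (Setoid.ker (Sum.elim id e)) E =
      if E = diag U then 1 else 0 := by
  cases nonempty_fintype V
  -- The identity of polynomials is checked at large integers `n`, where the coefficient counts
  -- colourings of `V`: the graph of `e` leaves only `f ∘ e.symm`.
  refine poly_ext_of_eval (Nat.card (U ⊕ U)) fun n hn => ?_
  obtain ⟨f, h, rfl⟩ := exists_ker E n hn
  obtain ⟨hf, hh⟩ := hE.injective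
  have h1 : ∀ g : V → Fin n,
      Setoid.ker (Sum.elim f g) = Setoid.ker (Sum.elim e id) ↔ g = f ∘ e.symm := fun g => by
    rw [← comap_swap_ker, ← comap_swap_ker id]
    exact (comap_swap_injective.eq_iff).trans (ker_eq_graph_iff e hf)
  have h2 : Setoid.ker (Sum.elim (f ∘ e.symm) h) = Setoid.ker (Sum.elim id e) ↔ f = h :=
    (ker_eq_graph_iff e hh).trans e.symm.surjective.injective_comp_right.eq_iff
  rw [← sum_recollement, Finset.sum_eq_single (f ∘ e.symm), ker_eq_diag_iff (Or.inl hf)]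
  · simp only [(h1 _).2 rfl, true_and, h2]
    split_ifs <;> simp
  · intro g _ hg
    rw [if_neg]
    exact fun h' => hg ((h1 g).1 h'.1)
  · simp

/-- The finite sets with at most `N` elements are infinitely many as objects; transport along a
bijection reduces them to finitely many standard ones, for every `t`. -/
theorem exists_retract_of_equiv {F : Type*} [Field F] (t : F)
    (X : (symmetricPresentation.specialize t).Cat) (U : FinSet) (e : X.ob.carrier ≃ U.carrier) :
    ∃ (a : X ⟶ ⟨U⟩) (b : ⟨U⟩ ⟶ X), a ≫ b = 𝟙 X := by
  let C : Recollements X.ob.carrier U.carrier := ⟨Setoid.ker (Sum.elim e id),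
    isRecollement_ker e.injective Function.injective_id⟩
  let D : Recollements U.carrier X.ob.carrier := ⟨Setoid.ker (Sum.elim id e),
    isRecollement_ker Function.injective_id e.injective⟩
  let φ := eval₂RingHom (Int.castRingHom F) t
  let a : Recollements X.ob.carrier U.carrier → F := Pi.single C 1
  let b : Recollements U.carrier X.ob.carrier → F := Pi.single D 1
  let _ : Fintype (Recollements X.ob.carrier U.carrier) := Fintype.ofFinite _
  let _ : Fintype (Recollements U.carrier X.ob.carrier) := Fintype.ofFinite _
  have key : ∀ E : Recollements X.ob.carrier X.ob.carrier,
      ∑ C', ∑ D', a C' * b D' * φ (recollementPoly C'.1 D'.1 E.1) =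
        if E = ⟨diag X.ob.carrier, diag_isRecollement _⟩ then 1 else 0 := by
    intro E
    rw [Finset.sum_eq_single C, Finset.sum_eq_single D]
    · simp only [a, b, Pi.single_eq_same, one_mul]
      rw [recollementPoly_graph e E.1 E.2, apply_ite φ, map_one, map_zero]
      exact if_congr ⟨fun h => Subtype.ext h, fun h => congrArg Subtype.val h⟩ rfl rfl
    · intro D' _ h
      simp [b, Pi.single_eq_of_ne h]
    · exact fun h => absurd (Finset.mem_univ _) h
    · intro C' _ h
      simp [a, Pi.single_eq_of_ne h]
    · exact fun h => absurd (Finset.mem_univ _) h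
  exact ⟨a, b, _root_.funext fun E => (key E).trans
    (Eq.trans (by congr) (Pi.single_apply _ _ _).symm)⟩

end Representations

end

end DeligneCat

/-! ### The four families -/

open DeligneCat

theorem mainTheorem3 (F : Type*) [Field F] [IsAlgClosed F] [CharZero F] :
    ((∀ N : ℕ, {t : F | ¬ IsSemisimpleAbelian (RepSLE F t N)}.Finite ∧
        ∀ t : F, ¬ IsSemisimpleAbelian (RepSLE F t N) → IsAlgebraic ℚ t) ∧
      (∀ t : F, Transcendental ℚ t → IsSemisimpleAbelian (RepS F t))) ∧
    ((∀ N : ℕ, {t : F | ¬ IsSemisimpleAbelian (RepGLLE F t N)}.Finite ∧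
        ∀ t : F, ¬ IsSemisimpleAbelian (RepGLLE F t N) → IsAlgebraic ℚ t) ∧
      (∀ t : F, Transcendental ℚ t → IsSemisimpleAbelian (RepGL F t))) ∧
    ((∀ N : ℕ, {t : F | ¬ IsSemisimpleAbelian (RepOLE F t N)}.Finite ∧
        ∀ t : F, ¬ IsSemisimpleAbelian (RepOLE F t N) → IsAlgebraic ℚ t) ∧
      (∀ t : F, Transcendental ℚ t → IsSemisimpleAbelian (RepO F t))) ∧
    ((∀ N : ℕ, {t : F | ¬ IsSemisimpleAbelian (RepSpLE F t N)}.Finite ∧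
        ∀ t : F, ¬ IsSemisimpleAbelian (RepSpLE F t N) → IsAlgebraic ℚ t) ∧
      (∀ t : F, Transcendental ℚ t → IsSemisimpleAbelian (RepSp F t))) := by
  refine ⟨⟨fun N => ?_, fun t ht => ?_⟩, ⟨fun N => ?_, fun t ht => ?_⟩, ⟨fun N => ?_, fun t ht => ?_⟩,
    fun N => ?_, fun t ht => ?_⟩
  · refine symmetricPresentation.finite_not_isSemisimpleAbelian
      (fun J _ Y => symmetricPresentation_hasTransposeRep Y) (fun U => Nat.card U.carrier ≤ N) F
      -- The sizes `0, …, N` account for the `N + 1` members of the generating family.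
      (fun j : Fin (N + 1) => ⟨Fin j⟩) (fun j => by simpa using Nat.lt_succ_iff.1 j.2)
      fun t X hX => ⟨⟨_, Nat.lt_succ_of_le hX⟩, exists_retract_of_equiv t X _ (Finite.equivFin _)⟩
  · exact symmetricPresentation.isSemisimpleAbelian_of_transcendental
      (fun J _ Y => symmetricPresentation_hasTransposeRep Y) F t ht
  · exact generalLinearPresentation.finite_not_isSemisimpleAbelian
      (fun J _ Y => generalLinearPresentation_hasTransposeRep Y) (fun x => x.1 + x.2 ≤ N) F
      -- Each of `p`, `q` is at most `N`, which makes the index type finite; here the objects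
      -- themselves occur in the family and identities serve as retractions.
      (fun j : {x : Fin (N + 1) × Fin (N + 1) // x.1.1 + x.2.1 ≤ N} => (j.1.1.1, j.1.2.1))
      (fun j => j.2) fun t X hX => ⟨⟨(⟨X.ob.1, by omega⟩, ⟨X.ob.2, by omega⟩), hX⟩, 𝟙 X, 𝟙 X,
        Category.id_comp _⟩
  · exact generalLinearPresentation.isSemisimpleAbelian_of_transcendental
      (fun J _ Y => generalLinearPresentation_hasTransposeRep Y) F t ht
  · exact orthogonalPresentation.finite_not_isSemisimpleAbelian
      (fun J _ Y => orthogonalPresentation_hasTransposeRep Y) (fun m => m ≤ N) F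
      (fun j : Fin (N + 1) => j.1) (fun j => Nat.lt_succ_iff.1 j.2)
      fun t X hX => ⟨⟨X.ob, Nat.lt_succ_of_le hX⟩, 𝟙 X, 𝟙 X, Category.id_comp _⟩
  · exact orthogonalPresentation.isSemisimpleAbelian_of_transcendental
      (fun J _ Y => orthogonalPresentation_hasTransposeRep Y) F t ht
  · exact symplecticPresentation.finite_not_isSemisimpleAbelian
      (fun J _ Y => symplecticPresentation_hasTransposeRep Y) (fun m => m ≤ N) F
      (fun j : Fin (N + 1) => j.1) (fun j => Nat.lt_succ_iff.1 j.2)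
      fun t X hX => ⟨⟨X.ob, Nat.lt_succ_of_le hX⟩, 𝟙 X, 𝟙 X, Category.id_comp _⟩
  · exact symplecticPresentation.isSemisimpleAbelian_of_transcendental
      (fun J _ Y => symplecticPresentation_hasTransposeRep Y) F t ht
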